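/- Let $x:\mathcal M^n\to\overline M(k)^{n+m}$ be a smooth isometric immersion into the space form of constant curvature $k$ (Euclidean space for $k=0$, the sphere of radius $1/\sqrt k$ for $k>0$, hyperbolic space for $k<0$). Assume that its normal bundle is flat, $R^\perp=0$, and that its index of relative nullity is $0$ everywhere (if $u\in T_p\mathcal M$ and $II(u,\cdot)=0$ then $u=0$). Let $g$ be the induced metric, $\nabla$ its Levi-Civita connection and $R(X,Y)Z=\nabla_X\nabla_YZ-\nabla_Y\nabla_XZ-\nabla_{[X,Y]}Z$ its curvature tensor. Let $\xi_1,\dots,\xi_m$ be a smooth local orthonormal frame of the normal bundle, $A_j=A_{\xi_j}$ the Weingarten operators, $g(A_\xi X,Y)=\langle II(X,Y),\xi\rangle$, and $$(\nabla_XA_j)Y=\nabla_X(A_jY)-A_j\nabla_XY-A_{\nabla^\perp_X\xi_j}Y$$ (the last term is zero if the frame is parallel in the normal bundle). Let $W=\sum_jA_j^2$, let $III(X,Y)=g(WX,Y)$ be the third fundamental form, i.e. the metric induced by the Gauss map, with Levi-Civita connection $\nabla^{III}$ and curvature tensor $R^{III}$ (the curvature of the Gauss image), and put $$T(X,Y)=\nabla^{III}_XY-\nabla_XY,\qquad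 J_j(X,Y)=W^{-1/2}\big((\nabla_XA_j)Y\big),$$ $$L(X,Y)Z=W^{-1}\sum_jA_j\big((R(X,Y)A_j)Z\big),\qquad (R(X,Y)A_j)Z=R(X,Y)(A_jZ)-A_j\big(R(X,Y)Z\big).$$ Here $W^{-1/2}$ is the positive definite $g$-self-adjoint square root of $W^{-1}$. For symmetric bilinear forms $h,h'$ with values in $T_p\mathcal M$ let $$(h\odot\!\!\wedge_{III}h')(X_1,X_2,X_3,X_4)=\tfrac12\big[III(h(X_1,X_3),h'(X_2,X_4))-III(h(X_1,X_4),h'(X_2,X_3))+III(h(X_2,X_4),h'(X_1,X_3))-III(h(X_2,X_3),h'(X_1,X_4))\big],$$ and for a $(0,4)$-tensor $S$ let $\widehat S$ be the $(1,3)$-tensor with $III(\widehat S(X,Y)Z,V)=S(X,Y,Z,V)$ for all $V$. Then $T(X,Y)=W^{-1}\sum_jA_j\big((\nabla_XA_j)Y\big)$, the forms $T$ and $J_1,\dots,J_m$ are symmetric, and $$R^{III}=R+L+\widehat{T\odot\!\!\wedge_{III}T}-\sum_{j=1}^m\widehat{J_j\odot\!\!\wedge_{III}J_j}.$$ -/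

import Mathlib

open scoped ContDiff Manifold Topology

noncomputable section

namespace GaussObata

/-- Coordinate space `ℝⁿ` of the submanifold. -/
abbrev Coord (n : ℕ) : Type := EuclideanSpace ℝ (Fin n)

/-- The vector space `ℝ^(N+1)` containing the `N`-dimensional space forms. -/
abbrev Amb (N : ℕ) : Type := EuclideanSpace ℝ (Fin (N + 1))

/-! ### Space forms -/

/-- Signature of the flat ambient form: Lorentzian (with time coordinate `0`) if `k < 0`,
Euclidean otherwise. -/
def ambSign (k : ℝ) {N : ℕ} (i : Fin (N + 1)) : ℝ := if k < 0 ∧ i = 0 then -1 else 1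

/-- The flat bilinear form `∑ i, ± a i * b i` on `ℝ^(N+1)`. -/
def ambForm (k : ℝ) (N : ℕ) : Amb N →L[ℝ] Amb N →L[ℝ] ℝ :=
  ∑ i : Fin (N + 1), ambSign k i •
    (EuclideanSpace.proj i : Amb N →L[ℝ] ℝ).smulRight (EuclideanSpace.proj i : Amb N →L[ℝ] ℝ)

theorem ambForm_apply (k : ℝ) (N : ℕ) (a b : Amb N) :
    ambForm k N a b = ∑ i, ambSign k i * (a i * b i) := by
  simp [ambForm]

/-- The space form of dimension `N` and curvature `k`: the hyperplane `ℝ^N = {a 0 = 0}` if `k = 0`,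
the sphere of radius `1 / √k` if `k > 0`, the upper sheet of the hyperboloid `⟨a, a⟩ = 1 / k` in
Lorentz space if `k < 0`; the metric is the restriction of `ambForm`. -/
def spaceForm (k : ℝ) (N : ℕ) : Set (Amb N) :=
  {a | (k = 0 → a 0 = 0) ∧ (k ≠ 0 → ambForm k N a a = 1 / k) ∧ (k < 0 → 0 < a 0)}

/-- A vector spanning the orthogonal complement of the tangent space of the space form at `a`. -/
def formNormal (k : ℝ) {N : ℕ} (a : Amb N) : Amb N :=
  if k = 0 then EuclideanSpace.single 0 1 else a

/-- Orthogonal projection of `ℝ^(N+1)` onto the tangent space of the space form at `a`. -/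
def formProj (k : ℝ) {N : ℕ} (a : Amb N) : Amb N →L[ℝ] Amb N :=
  ContinuousLinearMap.id ℝ (Amb N) -
    (ambForm k N (formNormal k a) (formNormal k a))⁻¹ •
      (ambForm k N (formNormal k a)).smulRight (formNormal k a)

/-! ### Riemannian geometry in coordinates -/

section Metric

variable {n : ℕ}

/-- Levi-Civita connection of the metric `G` (given by its coefficients in coordinates) on constant
vector fields: `2 G(Γ(u, v), w) = ∂_u G(v, w) + ∂_v G(u, w) - ∂_w G(u, v)`. -/
def christoffel (G : Coord n → Coord n →L[ℝ] Coord n →L[ℝ] ℝ) (y u v : Coord n) : Coord n :=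
  (G y).inverse ((1 / 2 : ℝ) •
    (fderiv ℝ G y u v + fderiv ℝ G y v u - ((fderiv ℝ G y).flip u).flip v))

/-- Levi-Civita covariant derivative `∇_u Y` at `y` of the vector field `Y`. -/
def covDeriv (G : Coord n → Coord n →L[ℝ] Coord n →L[ℝ] ℝ) (Y : Coord n → Coord n)
    (y u : Coord n) : Coord n :=
  fderiv ℝ Y y u + christoffel G y u (Y y)

/-- Riemann tensor `R(u, v) w = ∇_u ∇_v w - ∇_v ∇_u w`; here `u, v, w` are extended to constant
(hence commuting) coordinate vector fields. -/
def riemann (G : Coord n → Coord n →L[ℝ] Coord n →L[ℝ] ℝ) (y u v w : Coord n) : Coord n :=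
  covDeriv G (fun y' => covDeriv G (fun _ => w) y' v) y u -
    covDeriv G (fun y' => covDeriv G (fun _ => w) y' u) y v

/-- The `(1,3)`-tensor `Ŝ` with `g(Ŝ(u, v) w, z) = S(u, v, w, z)`. -/
def hat (g : Coord n →L[ℝ] Coord n →L[ℝ] ℝ)
    (S : Coord n → Coord n → Coord n → Coord n → ℝ) (u v w : Coord n) : Coord n :=
  Classical.epsilon fun a => ∀ z, g a z = S u v w z

/-- The inverse square root of an operator `W` that is positive definite with respect to the inner
product `g`: the `g`-self-adjoint, `g`-positive definite `S` with `S² = W⁻¹`. -/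
def invSqrt (g : Coord n →L[ℝ] Coord n →L[ℝ] ℝ) (W : Coord n →L[ℝ] Coord n) :
    Coord n →L[ℝ] Coord n :=
  Classical.epsilon fun S : Coord n →L[ℝ] Coord n =>
    (∀ u v, g (S u) v = g u (S v)) ∧ (∀ u, u ≠ 0 → 0 < g (S u) u) ∧
      (S ∘L S) ∘L W = ContinuousLinearMap.id ℝ (Coord n)

end Metric

/-- The generalized Kulkarni-Nomizu product of two bilinear forms with values in an inner product
space `(F, g)`. -/
def kulkarniNomizu {T F : Type*} (g : F → F → ℝ) (h k : T → T → F) (a b c d : T) : ℝ :=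
  1 / 2 * (g (h a c) (k b d) - g (h a d) (k b c) + g (h b d) (k a c) - g (h b c) (k a d))

/-! ### Submanifolds of space forms, in a local parametrization `X` -/

section Submanifold

variable {n m : ℕ}

/-- First fundamental form: the metric induced by the immersion. -/
def firstForm (k : ℝ) (X : Coord n → Amb (n + m)) (y : Coord n) :
    Coord n →L[ℝ] Coord n →L[ℝ] ℝ :=
  (ambForm k (n + m)).bilinearComp (fderiv ℝ X y) (fderiv ℝ X y)

/-- The vector `t` whose image `dX(t)` is the component of `ζ` tangent to the submanifold, i.e.
`g(t, v) = ⟨ζ, dX(v)⟩` for all `v`. -/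
def tangentPart (k : ℝ) (X : Coord n → Amb (n + m)) (y : Coord n) : Amb (n + m) →L[ℝ] Coord n :=
  (firstForm k X y).inverse ∘L
    (ambForm k (n + m)).bilinearComp (ContinuousLinearMap.id ℝ (Amb (n + m))) (fderiv ℝ X y)

/-- Normality to the submanifold, inside the tangent space of the space form. -/
def IsNormal (k : ℝ) (X : Coord n → Amb (n + m)) (y : Coord n) (ζ : Amb (n + m)) : Prop :=
  ambForm k (n + m) ζ (formNormal k (X y)) = 0 ∧ ∀ u, ambForm k (n + m) ζ (fderiv ℝ X y u) = 0

/-- The component, normal to the submanifold, of a vector tangent to the space form. -/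
def normalPart (k : ℝ) (X : Coord n → Amb (n + m)) (y : Coord n) :
    Amb (n + m) →L[ℝ] Amb (n + m) :=
  ContinuousLinearMap.id ℝ (Amb (n + m)) - fderiv ℝ X y ∘L tangentPart k X y

/-- Levi-Civita covariant derivative `∇̄_u ζ` in the space form of a field `ζ` along `X`: the
tangential component of the derivative in the flat space. -/
def ambDeriv (k : ℝ) (X : Coord n → Amb (n + m)) (ζ : Coord n → Amb (n + m)) (y u : Coord n) :
    Amb (n + m) :=
  formProj k (X y) (fderiv ℝ ζ y u)

/-- Second fundamental form `II(u, v) = (∇̄_u dX(v))^⊥`, where `v` is extended to a constant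
coordinate field, so that the flat derivative of `dX(v)` is the second derivative of `X`. -/
def secondForm (k : ℝ) (X : Coord n → Amb (n + m)) (y : Coord n) :
    Coord n →L[ℝ] Coord n →L[ℝ] Amb (n + m) :=
  ContinuousLinearMap.compL ℝ (Coord n) (Amb (n + m)) (Amb (n + m))
    (normalPart k X y ∘L formProj k (X y)) ∘L fderiv ℝ (fderiv ℝ X) y

/-- Weingarten operator: `g(A_ζ u, v) = ⟨II(u, v), ζ⟩`. -/
def weingarten (k : ℝ) (X : Coord n → Amb (n + m)) (y : Coord n) (ζ : Amb (n + m)) :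
    Coord n →L[ℝ] Coord n :=
  (firstForm k X y).inverse ∘L
    ContinuousLinearMap.compL ℝ (Coord n) (Amb (n + m)) ℝ (ambForm k (n + m) ζ) ∘L
      secondForm k X y

/-- Normal connection `∇^⊥_u ζ = (∇̄_u ζ)^⊥`. -/
def normalDeriv (k : ℝ) (X : Coord n → Amb (n + m)) (ζ : Coord n → Amb (n + m))
    (y u : Coord n) : Amb (n + m) :=
  normalPart k X y (ambDeriv k X ζ y u)

/-- Normal curvature `R^⊥(u, v) ζ = ∇^⊥_u ∇^⊥_v ζ - ∇^⊥_v ∇^⊥_u ζ` (for constant coordinate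
fields `u, v`). -/
def normalCurv (k : ℝ) (X : Coord n → Amb (n + m)) (ζ : Coord n → Amb (n + m))
    (y u v : Coord n) : Amb (n + m) :=
  normalDeriv k X (fun y' => normalDeriv k X ζ y' v) y u -
    normalDeriv k X (fun y' => normalDeriv k X ζ y' u) y v

/-- `II` is zero on no nonzero tangent vector: the relative nullity `{u | II(u, ·) = 0}` is `0`. -/
def ZeroNullityAt (k : ℝ) (X : Coord n → Amb (n + m)) (y : Coord n) : Prop :=
  ∀ u, (∀ v, secondForm k X y u v = 0) → u = 0

/-- All normal fields defined near `y` have zero normal curvature at `y`. -/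
def NormallyFlatAt (k : ℝ) (X : Coord n → Amb (n + m)) (y : Coord n) : Prop :=
  ∀ ζ : Coord n → Amb (n + m), ContDiffAt ℝ ∞ ζ y → (∀ᶠ y' in 𝓝 y, IsNormal k X y' (ζ y')) →
    ∀ u v, normalCurv k X ζ y u v = 0

/-- `ξ` is a smooth orthonormal frame of the normal bundle near `y`. -/
def IsNormalFrameAt (k : ℝ) (X : Coord n → Amb (n + m)) (ξ : Fin m → Coord n → Amb (n + m))
    (y : Coord n) : Prop :=
  (∀ j, ContDiffAt ℝ ∞ (ξ j) y) ∧
    ∀ᶠ y' in 𝓝 y, (∀ j, IsNormal k X y' (ξ j y')) ∧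
      ∀ i j, ambForm k (n + m) (ξ i y') (ξ j y') = if i = j then 1 else 0

/-- Canonical covariant derivative of the Weingarten operators along a normal field `ζ`:
`(∇_u A_ζ) v = ∇_u (A_ζ v) - A_ζ (∇_u v) - A_{∇^⊥_u ζ} v`, with `v` extended to a constant coordinate
field. The last term vanishes if `ζ` is parallel. -/
def nablaA (k : ℝ) (X : Coord n → Amb (n + m)) (ζ : Coord n → Amb (n + m)) (y u v : Coord n) :
    Coord n :=
  covDeriv (firstForm k X) (fun y' => weingarten k X y' (ζ y') v) y u -
    weingarten k X y (ζ y) (covDeriv (firstForm k X) (fun _ => v) y u) -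
    weingarten k X y (normalDeriv k X ζ y u) v

/-- The operator `W = ∑ j, A_j²`. -/
def obata (k : ℝ) (X : Coord n → Amb (n + m)) (ξ : Fin m → Coord n → Amb (n + m)) (y : Coord n) :
    Coord n →L[ℝ] Coord n :=
  ∑ j, weingarten k X y (ξ j y) ∘L weingarten k X y (ξ j y)

/-- Third fundamental form `III(u, v) = g(W u, v)`. -/
def thirdForm (k : ℝ) (X : Coord n → Amb (n + m)) (ξ : Fin m → Coord n → Amb (n + m))
    (y : Coord n) : Coord n →L[ℝ] Coord n →L[ℝ] ℝ :=
  firstForm k X y ∘L obata k X ξ y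

/-- The difference `T(u, v) = ∇^III_u v - ∇_u v` of the Levi-Civita connections. -/
def diffT (k : ℝ) (X : Coord n → Amb (n + m)) (ξ : Fin m → Coord n → Amb (n + m))
    (y u v : Coord n) : Coord n :=
  covDeriv (thirdForm k X ξ) (fun _ => v) y u - covDeriv (firstForm k X) (fun _ => v) y u

/-- `J_j(u, v) = W^{-1/2} ((∇_u A_j) v)`. -/
def tensorJ (k : ℝ) (X : Coord n → Amb (n + m)) (ξ : Fin m → Coord n → Amb (n + m))
    (y : Coord n) (j : Fin m) (u v : Coord n) : Coord n :=
  invSqrt (firstForm k X y) (obata k X ξ y) (nablaA k X (ξ j) y u v)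

/-- The curvature `R(u, v)` of the connection acting, as a derivation, on an operator `A`:
`(R(u, v) A) w = R(u, v) (A w) - A (R(u, v) w)`. -/
def curvOp (k : ℝ) (X : Coord n → Amb (n + m)) (y : Coord n) (A : Coord n →L[ℝ] Coord n)
    (u v w : Coord n) : Coord n :=
  riemann (firstForm k X) y u v (A w) - A (riemann (firstForm k X) y u v w)

/-- `L(u, v) w = W⁻¹ ∑ j, A_j ((R(u, v) A_j) w)`. -/
def tensorL (k : ℝ) (X : Coord n → Amb (n + m)) (ξ : Fin m → Coord n → Amb (n + m))
    (y u v w : Coord n) : Coord n :=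
  (obata k X ξ y).inverse
    (∑ j, weingarten k X y (ξ j y) (curvOp k X y (weingarten k X y (ξ j y)) u v w))

end Submanifold

end GaussObata

end

noncomputable section

set_option maxSynthPendingDepth 3

namespace GaussObata

/-! ### Levi-Civita calculus of a metric given in coordinates. -/

section Metric

variable {n : ℕ}

/-! Trivialise the normal bundle by the frame `ξ`, let `θ` be the matrix of its connection forms,
and send a tangent vector `v` to the tuple `A v = (A_1 v, …, A_m v)` in `TM ⊗ ℝᵐ`. Zero nullity
makes this bundle map injective, and III is the pull-back under it of `g` tensored with the standard
inner product. Let `D` be the connection on `TM ⊗ ℝᵐ` built from `∇` and `θ`. The Codazzi equation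
says that `D_u (A v)` is symmetric in coordinate fields `u, v`, so `D` projected to the image of `A`
is torsion free. It is metric because `θ` is antisymmetric, hence it is the Levi-Civita connection
of III (`CodazziTuple.pull_christoffelMap`). Subtracting `∇` gives `III(T(u, v), w) = ∑ j, g((∇_u
A_j) v, A_j w)`, which is the formula for `T`. The curvature formula is then the Gauss equation of
the subbundle `A(TM)` (`CodazziTuple.pull_riemann`). Since the normal connection is flat, `D` has
curvature `R ⊗ id`, whose compression to `A(TM)` is `R + L` (`FramedPatch.thirdForm_tensorL`). The
second fundamental form of the subbundle is `(∇_u A) v - A T(u, v)`, where `A T` is the orthogonal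
projection of `(∇A)`. By Pythagoras its products are `∑ j, g(∇A_j, ∇A_j) - III(T, T)`, and
`III(W^{-1/2} a, W^{-1/2} b) = g(a, b)` turns the first sum into products of the `J_j`
(`FramedPatch.thirdForm_invSqrt`). The Codazzi equation itself comes from the symmetry of the third
derivative of the parametrization in the flat ambient space (`FramedPatch.firstForm_nabla`). -/

/-- `ContinuousLinearMap.inverse` has value `0` on a map that is not invertible, so every formula
that raises an index needs this. -/
theorem isInvertible_of_nondegenerate {G : Coord n →L[ℝ] Coord n →L[ℝ] ℝ}
    (h : ∀ u, (∀ v, G u v = 0) → u = 0) : G.IsInvertible := by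
  have hinj : Function.Injective (G : Coord n →ₗ[ℝ] Coord n →L[ℝ] ℝ) := by
    rw [← LinearMap.ker_eq_bot, LinearMap.ker_eq_bot']
    intro u hu
    exact h u fun v => by
      have := congrArg (fun φ : Coord n →L[ℝ] ℝ => φ v) hu
      simpa using this
  have hdim : Module.finrank ℝ (Coord n) = Module.finrank ℝ (Coord n →L[ℝ] ℝ) := by
    rw [← (LinearMap.toContinuousLinearMap (𝕜 := ℝ) (E := Coord n) (F' := ℝ)).finrank_eq]
    exact (Subspace.dual_finrank_eq (K := ℝ) (V := Coord n)).symm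
  refine ⟨(LinearMap.linearEquivOfInjective _ hinj hdim).toContinuousLinearEquiv, ?_⟩
  ext u v
  rfl

theorem contDiffAt_clm_inverse {E₁ E₂ E₃ : Type*} [NormedAddCommGroup E₁] [NormedSpace ℝ E₁]
    [NormedAddCommGroup E₂] [NormedSpace ℝ E₂] [NormedAddCommGroup E₃] [NormedSpace ℝ E₃]
    [CompleteSpace E₂] {r : WithTop ℕ∞} {G : E₁ → E₂ →L[ℝ] E₃} {y : E₁}
    (hG : ContDiffAt ℝ r G y) (h : (G y).IsInvertible) :
    ContDiffAt ℝ r (fun y' => (G y').inverse) y := by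
  obtain ⟨e, he⟩ := h
  have := contDiffAt_map_inverse (𝕜 := ℝ) (n := r) e
  rw [he] at this
  exact this.comp y hG

theorem contDiffAt_clm_flip {E₁ E₂ E₃ E₄ : Type*} [NormedAddCommGroup E₁] [NormedSpace ℝ E₁]
    [NormedAddCommGroup E₂] [NormedSpace ℝ E₂] [NormedAddCommGroup E₃] [NormedSpace ℝ E₃]
    [NormedAddCommGroup E₄] [NormedSpace ℝ E₄]
    {r : WithTop ℕ∞} {f : E₁ → E₂ →L[ℝ] E₃ →L[ℝ] E₄} {y : E₁} (hf : ContDiffAt ℝ r f y) :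
    ContDiffAt ℝ r (fun y' => (f y').flip) y :=
  (ContinuousLinearMap.flipₗᵢ ℝ E₂ E₃ E₄).contDiff.contDiffAt.comp y hf

/-- The Christoffel operator `v ↦ Γ(u, v)` of the metric `G` as a continuous linear map. -/
def christoffelMap (G : Coord n → Coord n →L[ℝ] Coord n →L[ℝ] ℝ) (y u : Coord n) :
    Coord n →L[ℝ] Coord n :=
  (G y).inverse ∘L ((1 / 2 : ℝ) •
    (fderiv ℝ G y u + (fderiv ℝ G y).flip u - ((fderiv ℝ G y).flip u).flip))

variable {G : Coord n → Coord n →L[ℝ] Coord n →L[ℝ] ℝ} {y : Coord n}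

theorem covDeriv_eq (Y : Coord n → Coord n) (u : Coord n) :
    covDeriv G Y y u = fderiv ℝ Y y u + christoffelMap G y u (Y y) := rfl

theorem covDeriv_const (u v : Coord n) :
    covDeriv G (fun _ => v) y u = christoffelMap G y u v := by
  simp [covDeriv_eq]

theorem contDiffAt_christoffelMap {r s : WithTop ℕ∞} (hG : ContDiffAt ℝ r G y)
    (hinv : (G y).IsInvertible) (hr : s + 1 ≤ r) (u : Coord n) :
    ContDiffAt ℝ s (fun y' => christoffelMap G y' u) y := by
  have h1 : ContDiffAt ℝ s (fderiv ℝ G) y := hG.fderiv_right hr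
  have h2 : ContDiffAt ℝ s (fun y' => (G y').inverse) y :=
    contDiffAt_clm_inverse (hG.of_le (le_trans le_self_add hr)) hinv
  have hflip : ContDiffAt ℝ s (fun y' => (fderiv ℝ G y').flip u) y :=
    (contDiffAt_clm_flip h1).clm_apply contDiffAt_const
  have hflip2 : ContDiffAt ℝ s (fun y' => ((fderiv ℝ G y').flip u).flip) y :=
    contDiffAt_clm_flip hflip
  exact h2.clm_comp ((((h1.clm_apply contDiffAt_const).add hflip).sub hflip2).const_smul _)

theorem metric_christoffelMap (hinv : (G y).IsInvertible) (u v w : Coord n) :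
    G y (christoffelMap G y u v) w =
      1 / 2 * (fderiv ℝ G y u v w + fderiv ℝ G y v u w - fderiv ℝ G y w u v) := by
  simp [christoffelMap, hinv.self_apply_inverse]

theorem fderiv_metric_apply (hG : DifferentiableAt ℝ G y) (u v w : Coord n) :
    fderiv ℝ (fun y' => G y' v w) y u = fderiv ℝ G y u v w := by
  have h := (hG.hasFDerivAt.clm_apply (hasFDerivAt_const v y)).clm_apply (hasFDerivAt_const w y)
  rw [h.fderiv]
  simp

theorem fderiv_metric_symm (hG : DifferentiableAt ℝ G y)
    (hsymm : ∀ᶠ y' in 𝓝 y, ∀ u v, G y' u v = G y' v u) (u v w : Coord n) :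
    fderiv ℝ G y u v w = fderiv ℝ G y u w v := by
  rw [← fderiv_metric_apply hG, ← fderiv_metric_apply hG]
  have : (fun y' => G y' v w) =ᶠ[𝓝 y] fun y' => G y' w v := hsymm.mono fun y' h => h v w
  rw [this.fderiv_eq]

theorem metric_left_cancel (hinv : (G y).IsInvertible) {a b : Coord n}
    (h : ∀ w, G y a w = G y b w) : a = b :=
  hinv.injective (ContinuousLinearMap.ext h)

theorem christoffelMap_symm (hG : DifferentiableAt ℝ G y)
    (hsymm : ∀ᶠ y' in 𝓝 y, ∀ u v, G y' u v = G y' v u) (hinv : (G y).IsInvertible)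
    (u v : Coord n) : christoffelMap G y u v = christoffelMap G y v u := by
  refine metric_left_cancel hinv fun w => ?_
  rw [metric_christoffelMap hinv, metric_christoffelMap hinv, fderiv_metric_symm hG hsymm w u v]
  ring

theorem fderiv_metric_eq (hG : DifferentiableAt ℝ G y)
    (hsymm : ∀ᶠ y' in 𝓝 y, ∀ u v, G y' u v = G y' v u) (hinv : (G y).IsInvertible)
    (u v w : Coord n) :
    fderiv ℝ G y u v w =
      G y (christoffelMap G y u v) w + G y v (christoffelMap G y u w) := by
  rw [hsymm.self_of_nhds v, metric_christoffelMap hinv, metric_christoffelMap hinv,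
    fderiv_metric_symm hG hsymm w u v, fderiv_metric_symm hG hsymm u w v,
    fderiv_metric_symm hG hsymm v u w]
  ring

/-- Koszul: a symmetric bilinear `C` compatible with the metric is the Christoffel operator. -/
theorem christoffelMap_unique (hsymm : ∀ᶠ y' in 𝓝 y, ∀ u v, G y' u v = G y' v u)
    (hinv : (G y).IsInvertible) {C : Coord n → Coord n → Coord n} (hC : ∀ u v, C u v = C v u)
    (hcompat : ∀ u v w, fderiv ℝ G y u v w = G y (C u v) w + G y v (C u w)) (u v : Coord n) :
    christoffelMap G y u v = C u v := by
  refine metric_left_cancel hinv fun w => ?_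
  have hs := hsymm.self_of_nhds
  rw [metric_christoffelMap hinv, hcompat, hcompat, hcompat, hC v u, hC w u, hC w v,
    hs (C u w) v, hs u (C v w)]
  ring

theorem fderiv_metric_fields {Y Z : Coord n → Coord n} (hG : DifferentiableAt ℝ G y)
    (hsymm : ∀ᶠ y' in 𝓝 y, ∀ u v, G y' u v = G y' v u) (hinv : (G y).IsInvertible)
    (hY : DifferentiableAt ℝ Y y) (hZ : DifferentiableAt ℝ Z y) (u : Coord n) :
    fderiv ℝ (fun y' => G y' (Y y') (Z y')) y u =
      G y (covDeriv G Y y u) (Z y) + G y (Y y) (covDeriv G Z y u) := by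
  have h := (hG.hasFDerivAt.clm_apply hY.hasFDerivAt).clm_apply hZ.hasFDerivAt
  rw [h.fderiv]
  simp only [covDeriv_eq, map_add, add_apply,
    ContinuousLinearMap.comp_apply, ContinuousLinearMap.flip_apply,
    fderiv_metric_eq hG hsymm hinv u (Y y) (Z y)]
  ring

theorem covDeriv_clm_apply {A : Coord n → Coord n →L[ℝ] Coord n} (hA : DifferentiableAt ℝ A y)
    (u v : Coord n) :
    covDeriv G (fun y' => A y' v) y u = fderiv ℝ A y u v + christoffelMap G y u (A y v) := by
  rw [covDeriv_eq, (hA.hasFDerivAt.clm_apply (hasFDerivAt_const v y)).fderiv]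
  simp

theorem covDeriv_sum {ι : Type*} (s : Finset ι) {Y : ι → Coord n → Coord n}
    (hY : ∀ i ∈ s, DifferentiableAt ℝ (Y i) y) (u : Coord n) :
    covDeriv G (fun y' => ∑ i ∈ s, Y i y') y u = ∑ i ∈ s, covDeriv G (Y i) y u := by
  simp only [covDeriv_eq, map_sum, Finset.sum_add_distrib]
  rw [fderiv_fun_sum hY]
  simp

theorem covDeriv_smul {f : Coord n → ℝ} {Y : Coord n → Coord n} (hf : DifferentiableAt ℝ f y)
    (hY : DifferentiableAt ℝ Y y) (u : Coord n) :
    covDeriv G (fun y' => f y' • Y y') y u = fderiv ℝ f y u • Y y + f y • covDeriv G Y y u := by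
  simp only [covDeriv_eq, (hf.hasFDerivAt.fun_smul hY.hasFDerivAt).fderiv, map_smul]
  simp
  abel

theorem covDeriv_sub {Y Z : Coord n → Coord n} (hY : DifferentiableAt ℝ Y y)
    (hZ : DifferentiableAt ℝ Z y) (u : Coord n) :
    covDeriv G (fun y' => Y y' - Z y') y u = covDeriv G Y y u - covDeriv G Z y u := by
  simp only [covDeriv_eq, fderiv_fun_sub hY hZ, map_sub]
  simp
  abel

theorem contDiffAt_covDeriv {Y : Coord n → Coord n} {r s : WithTop ℕ∞} (hG : ContDiffAt ℝ r G y)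
    (hinv : (G y).IsInvertible) (hY : ContDiffAt ℝ r Y y) (hr : s + 1 ≤ r) (u : Coord n) :
    ContDiffAt ℝ s (fun y' => covDeriv G Y y' u) y := by
  simp only [covDeriv_eq]
  exact ((hY.fderiv_right hr).clm_apply contDiffAt_const).add
    ((contDiffAt_christoffelMap hG hinv hr u).clm_apply
      (hY.of_le (le_trans le_self_add hr)))

/-- The first term is symmetric in `u, v`, and the two terms with a first derivative of `Y` are
exchanged by swapping `u` and `v`. Antisymmetrizing therefore leaves an expression in the value `Y
y` alone. -/
theorem covDeriv_covDeriv {Y : Coord n → Coord n} (hG : ContDiffAt ℝ 2 G y)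
    (hinv : (G y).IsInvertible) (hY : ContDiffAt ℝ 2 Y y) (u v : Coord n) :
    covDeriv G (fun y' => covDeriv G Y y' v) y u =
      fderiv ℝ (fderiv ℝ Y) y u v + fderiv ℝ (fun y' => christoffelMap G y' v) y u (Y y) +
        christoffelMap G y v (fderiv ℝ Y y u) + christoffelMap G y u (fderiv ℝ Y y v) +
          christoffelMap G y u (christoffelMap G y v (Y y)) := by
  have h1 : DifferentiableAt ℝ (fderiv ℝ Y) y :=
    (hY.fderiv_right (m := 1) (by norm_num)).differentiableAt (by norm_num)
  have h2 : DifferentiableAt ℝ (fun y' => christoffelMap G y' v) y :=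
    (contDiffAt_christoffelMap (s := 1) hG hinv (by norm_num) v).differentiableAt (by norm_num)
  have h3 := (h1.hasFDerivAt.clm_apply (hasFDerivAt_const v y)).fun_add
    (h2.hasFDerivAt.clm_apply (hY.differentiableAt (by norm_num)).hasFDerivAt)
  rw [covDeriv_eq]
  simp only [covDeriv_eq]
  rw [h3.fderiv]
  simp
  abel

/-- The Ricci identity for vector fields along commuting coordinate directions. -/
theorem covDeriv_covDeriv_sub {Y : Coord n → Coord n} (hG : ContDiffAt ℝ 2 G y)
    (hinv : (G y).IsInvertible) (hY : ContDiffAt ℝ 2 Y y) (u v : Coord n) :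
    covDeriv G (fun y' => covDeriv G Y y' v) y u - covDeriv G (fun y' => covDeriv G Y y' u) y v =
      riemann G y u v (Y y) := by
  have hs : fderiv ℝ (fderiv ℝ Y) y u v = fderiv ℝ (fderiv ℝ Y) y v u :=
    (hY.isSymmSndFDerivAt (by simp)).eq u v
  rw [riemann, covDeriv_covDeriv hG hinv hY, covDeriv_covDeriv hG hinv hY,
    covDeriv_covDeriv hG hinv contDiffAt_const, covDeriv_covDeriv hG hinv contDiffAt_const, hs]
  simp
  abel

end Metric

/-! ### Gauss equation for the image of a Codazzi tuple in `TM ⊗ ℝᵐ`. -/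

section TwistedGauss

variable {n m : ℕ}

/-- The covariant derivative of the section `(A j v)_j` of `TM ⊗ ℝᵐ`, where the connection on `ℝᵐ`
is given by the matrix of one-forms `θ`. -/
def twistedDeriv (g : Coord n → Coord n →L[ℝ] Coord n →L[ℝ] ℝ)
    (A : Fin m → Coord n → Coord n →L[ℝ] Coord n) (θ : Fin m → Fin m → Coord n → Coord n →L[ℝ] ℝ)
    (j : Fin m) (y u v : Coord n) : Coord n :=
  covDeriv g (fun y' => A j y' v) y u - ∑ l, θ j l y u • A l y v

/-- The covariant derivative of the tuple of operators `A`. -/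
def twistedNabla (g : Coord n → Coord n →L[ℝ] Coord n →L[ℝ] ℝ)
    (A : Fin m → Coord n → Coord n →L[ℝ] Coord n) (θ : Fin m → Fin m → Coord n → Coord n →L[ℝ] ℝ)
    (j : Fin m) (y u v : Coord n) : Coord n :=
  twistedDeriv g A θ j y u v - A j y (christoffelMap g y u v)

/-- A tuple of self-adjoint operators that is symmetric in the sense of Codazzi for a metric `g` and
a metric connection `θ` on `ℝᵐ`, together with the metric `h(a, b) = ∑ j, g(A j a, A j b)`. -/
structure CodazziTuple (U : Set (Coord n)) (g h : Coord n → Coord n →L[ℝ] Coord n →L[ℝ] ℝ)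
    (A : Fin m → Coord n → Coord n →L[ℝ] Coord n)
    (θ : Fin m → Fin m → Coord n → Coord n →L[ℝ] ℝ) : Prop where
  isOpen : IsOpen U
  metric_contDiffAt : ∀ y ∈ U, ContDiffAt ℝ 2 g y
  metric_symm : ∀ y ∈ U, ∀ u v, g y u v = g y v u
  metric_isInvertible : ∀ y ∈ U, (g y).IsInvertible
  pull_contDiffAt : ∀ y ∈ U, ContDiffAt ℝ 2 h y
  pull_isInvertible : ∀ y ∈ U, (h y).IsInvertible
  pull_apply : ∀ y ∈ U, ∀ u v, h y u v = ∑ j, g y (A j y u) (A j y v)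
  op_contDiffAt : ∀ j, ∀ y ∈ U, ContDiffAt ℝ 2 (A j) y
  conn_contDiffAt : ∀ i j, ∀ y ∈ U, ContDiffAt ℝ 1 (θ i j) y
  conn_antisymm : ∀ i j, ∀ y ∈ U, ∀ u, θ i j y u = -θ j i y u
  codazzi : ∀ j, ∀ y ∈ U, ∀ u v, twistedNabla g A θ j y u v = twistedNabla g A θ j y v u

variable {U : Set (Coord n)} {g h : Coord n → Coord n →L[ℝ] Coord n →L[ℝ] ℝ}
  {A : Fin m → Coord n → Coord n →L[ℝ] Coord n} {θ : Fin m → Fin m → Coord n → Coord n →L[ℝ] ℝ}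
  {y : Coord n}

theorem covDeriv_op_eq (j : Fin m) (u v : Coord n) :
    covDeriv g (fun y' => A j y' v) y u =
      twistedDeriv g A θ j y u v + ∑ l, θ j l y u • A l y v := by
  simp [twistedDeriv]

theorem twistedDeriv_eq (j : Fin m) (u v : Coord n) :
    twistedDeriv g A θ j y u v =
      twistedNabla g A θ j y u v + A j y (christoffelMap g y u v) := by
  simp [twistedNabla]

namespace CodazziTuple

variable (H : CodazziTuple U g h A θ) (hy : y ∈ U)
include H hy

theorem eventually_mem : ∀ᶠ y' in 𝓝 y, y' ∈ U := H.isOpen.mem_nhds hy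

theorem metric_symm_eventually : ∀ᶠ y' in 𝓝 y, ∀ u v, g y' u v = g y' v u :=
  (H.eventually_mem hy).mono H.metric_symm

theorem pull_symm (u v : Coord n) : h y u v = h y v u := by
  simp only [H.pull_apply y hy]
  exact Finset.sum_congr rfl fun j _ => H.metric_symm y hy _ _

theorem pull_symm_eventually : ∀ᶠ y' in 𝓝 y, ∀ u v, h y' u v = h y' v u :=
  (H.eventually_mem hy).mono fun _ hy' => H.pull_symm hy'

theorem metric_differentiableAt : DifferentiableAt ℝ g y :=
  (H.metric_contDiffAt y hy).differentiableAt (by norm_num)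

theorem pull_differentiableAt : DifferentiableAt ℝ h y :=
  (H.pull_contDiffAt y hy).differentiableAt (by norm_num)

theorem op_apply_contDiffAt (j : Fin m) (v : Coord n) :
    ContDiffAt ℝ 2 (fun y' => A j y' v) y :=
  (H.op_contDiffAt j y hy).clm_apply contDiffAt_const

theorem op_apply_differentiableAt (j : Fin m) (v : Coord n) :
    DifferentiableAt ℝ (fun y' => A j y' v) y :=
  (H.op_apply_contDiffAt hy j v).differentiableAt (by norm_num)

theorem conn_apply_differentiableAt (i j : Fin m) (v : Coord n) :
    DifferentiableAt ℝ (fun y' => θ i j y' v) y :=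
  ((H.conn_contDiffAt i j y hy).differentiableAt (by norm_num)).clm_apply
    (differentiableAt_const v)

theorem covDeriv_op_differentiableAt (j : Fin m) (u v : Coord n) :
    DifferentiableAt ℝ (fun y' => covDeriv g (fun y'' => A j y'' v) y' u) y :=
  (contDiffAt_covDeriv (s := 1) (H.metric_contDiffAt y hy) (H.metric_isInvertible y hy)
    (H.op_apply_contDiffAt hy j v) (by norm_num) u).differentiableAt (by norm_num)

theorem conn_smul_op_differentiableAt (j : Fin m) (u v : Coord n) :
    ∀ l ∈ Finset.univ, DifferentiableAt ℝ (fun y' => θ j l y' u • A l y' v) y := fun l _ =>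
  (H.conn_apply_differentiableAt hy j l u).fun_smul (H.op_apply_differentiableAt hy l v)

theorem twistedDeriv_differentiableAt (j : Fin m) (u v : Coord n) :
    DifferentiableAt ℝ (fun y' => twistedDeriv g A θ j y' u v) y :=
  (H.covDeriv_op_differentiableAt hy j u v).fun_sub
    (DifferentiableAt.fun_sum (H.conn_smul_op_differentiableAt hy j u v))

/-- Codazzi plus the symmetry of the Christoffel operator of `g`; this becomes the vanishing torsion
of the projected connection. -/
theorem twistedDeriv_symm (j : Fin m) (u v : Coord n) :
    twistedDeriv g A θ j y u v = twistedDeriv g A θ j y v u := by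
  rw [twistedDeriv_eq, twistedDeriv_eq, H.codazzi j y hy, christoffelMap_symm
    (H.metric_differentiableAt hy) (H.metric_symm_eventually hy) (H.metric_isInvertible y hy)]

theorem sum_conn_antisymm (u : Coord n) (f : Fin m → Fin m → ℝ) :
    ∑ j, ∑ l, θ j l y u * f j l = -∑ j, ∑ l, θ j l y u * f l j := by
  rw [Finset.sum_comm, ← Finset.sum_neg_distrib]
  refine Finset.sum_congr rfl fun j _ => ?_
  rw [← Finset.sum_neg_distrib]
  refine Finset.sum_congr rfl fun l _ => ?_
  rw [H.conn_antisymm l j y hy]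
  ring

/-- The twisted connection is metric: the terms in `θ` produced by the two factors cancel after
summation over `j`, by antisymmetry. -/
theorem fderiv_pull (u v w : Coord n) :
    fderiv ℝ h y u v w = ∑ j, g y (twistedDeriv g A θ j y u v) (A j y w) +
      ∑ j, g y (A j y v) (twistedDeriv g A θ j y u w) := by
  rw [← fderiv_metric_apply (H.pull_differentiableAt hy)]
  have he : (fun y' => h y' v w) =ᶠ[𝓝 y] fun y' => ∑ j, g y' (A j y' v) (A j y' w) :=
    (H.eventually_mem hy).mono fun y' hy' => H.pull_apply y' hy' v w
  have hd (j : Fin m) : DifferentiableAt ℝ (fun y' => g y' (A j y' v) (A j y' w)) y :=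
    ((H.metric_differentiableAt hy).clm_apply (H.op_apply_differentiableAt hy j v)).clm_apply
      (H.op_apply_differentiableAt hy j w)
  rw [he.fderiv_eq, fderiv_fun_sum fun j _ => hd j, sum_apply]
  have hj (j : Fin m) : fderiv ℝ (fun y' => g y' (A j y' v) (A j y' w)) y u =
      g y (twistedDeriv g A θ j y u v) (A j y w) + g y (A j y v) (twistedDeriv g A θ j y u w) +
        (∑ l, θ j l y u * g y (A l y v) (A j y w) +
          ∑ l, θ j l y u * g y (A j y v) (A l y w)) := by
    rw [fderiv_metric_fields (H.metric_differentiableAt hy) (H.metric_symm_eventually hy)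
      (H.metric_isInvertible y hy) (H.op_apply_differentiableAt hy j v)
      (H.op_apply_differentiableAt hy j w), covDeriv_op_eq (θ := θ), covDeriv_op_eq (θ := θ)]
    simp only [map_add, map_sum, map_smul, add_apply, sum_apply, smul_apply, smul_eq_mul]
    ring
  simp only [hj, Finset.sum_add_distrib]
  rw [H.sum_conn_antisymm hy u fun j l => g y (A l y v) (A j y w)]
  ring

/-- The Levi-Civita connection of the pulled back metric is the projected twisted connection. -/
theorem pull_christoffelMap (u v w : Coord n) :
    h y (christoffelMap h y u v) w = ∑ j, g y (twistedDeriv g A θ j y u v) (A j y w) := by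
  -- The candidate connection is the orthogonal projection of `D_a (A b)` to the image of `A`, read
  -- back in the tangent space by raising an index with `h`.
  have hC (a b c : Coord n) :
      h y ((h y).inverse (∑ j, g y (twistedDeriv g A θ j y a b) ∘L A j y)) c =
        ∑ j, g y (twistedDeriv g A θ j y a b) (A j y c) := by
    rw [(H.pull_isInvertible y hy).self_apply_inverse]
    simp
  rw [christoffelMap_unique (H.pull_symm_eventually hy) (H.pull_isInvertible y hy)
    (C := fun a b => (h y).inverse (∑ j, g y (twistedDeriv g A θ j y a b) ∘L A j y)), hC]
  · intro a b
    simp only [H.twistedDeriv_symm hy]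
  · intro a b c
    rw [hC, H.pull_symm hy b, hC, H.fderiv_pull hy]
    congr 1
    exact Finset.sum_congr rfl fun j _ => H.metric_symm y hy _ _

theorem pull_christoffelMap_sub (u v w : Coord n) :
    h y (christoffelMap h y u v - christoffelMap g y u v) w =
      ∑ j, g y (twistedNabla g A θ j y u v) (A j y w) := by
  rw [map_sub, sub_apply, H.pull_christoffelMap hy, H.pull_apply y hy, ← Finset.sum_sub_distrib]
  refine Finset.sum_congr rfl fun j _ => ?_
  rw [twistedNabla, map_sub, sub_apply]

/-- Both sides are the inner product of the components of `D_v (A w)` and `D_u (A z)` orthogonal to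
the image of `A`. Passing from `D (A w)` to `(∇A) w` subtracts an element of that image, which
leaves these components unchanged. -/
theorem sum_twistedDeriv_sub (u v w z : Coord n) :
    ∑ j, g y (twistedDeriv g A θ j y v w) (twistedDeriv g A θ j y u z) -
        h y (christoffelMap h y v w) (christoffelMap h y u z) =
      ∑ j, g y (twistedNabla g A θ j y v w) (twistedNabla g A θ j y u z) -
        h y (christoffelMap h y v w - christoffelMap g y v w)
          (christoffelMap h y u z - christoffelMap g y u z) := by
  have h1 := H.pull_christoffelMap_sub hy v w (christoffelMap g y u z)
  have h2 := H.pull_christoffelMap_sub hy u z (christoffelMap g y v w)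
  have h3 := H.pull_apply y hy (christoffelMap g y v w) (christoffelMap g y u z)
  have hexp : ∑ j, g y (twistedDeriv g A θ j y v w) (twistedDeriv g A θ j y u z) =
      ∑ j, g y (twistedNabla g A θ j y v w) (twistedNabla g A θ j y u z) +
      ∑ j, g y (twistedNabla g A θ j y v w) (A j y (christoffelMap g y u z)) +
      ∑ j, g y (twistedNabla g A θ j y u z) (A j y (christoffelMap g y v w)) +
      ∑ j, g y (A j y (christoffelMap g y v w)) (A j y (christoffelMap g y u z)) := by
    simp only [← Finset.sum_add_distrib]
    refine Finset.sum_congr rfl fun j _ => ?_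
    rw [twistedDeriv_eq, twistedDeriv_eq, H.metric_symm y hy (twistedNabla g A θ j y u z)
      (A j y (christoffelMap g y v w))]
    simp only [map_add, add_apply]
    ring
  rw [hexp, ← h1, ← h2, ← h3]
  simp only [map_sub, sub_apply]
  rw [H.pull_symm hy (christoffelMap g y v w) (christoffelMap h y u z),
    H.pull_symm hy (christoffelMap g y v w) (christoffelMap g y u z),
    H.pull_symm hy (christoffelMap g y u z) (christoffelMap g y v w)]
  ring

theorem covDeriv_twistedDeriv (j : Fin m) (u v w : Coord n) :
    covDeriv g (fun y' => twistedDeriv g A θ j y' v w) y u =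
      covDeriv g (fun y' => covDeriv g (fun y'' => A j y'' w) y' v) y u -
        ∑ l, (fderiv ℝ (θ j l) y u v • A l y w +
          θ j l y v • (twistedDeriv g A θ l y u w + ∑ p, θ l p y u • A p y w)) := by
  simp only [twistedDeriv]
  rw [covDeriv_sub (H.covDeriv_op_differentiableAt hy j v w)
    (DifferentiableAt.fun_sum (H.conn_smul_op_differentiableAt hy j v w)),
    covDeriv_sum _ (H.conn_smul_op_differentiableAt hy j v w)]
  congr 1
  refine Finset.sum_congr rfl fun l _ => ?_
  rw [covDeriv_smul (H.conn_apply_differentiableAt hy j l v) (H.op_apply_differentiableAt hy l w),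
    (((H.conn_contDiffAt j l y hy).differentiableAt (by norm_num)).hasFDerivAt.clm_apply
      (hasFDerivAt_const v y)).fderiv]
  simp

/-- Obtained by differentiating `pull_christoffelMap` along `u`, with `w` and `z` constant, and
using that `h` and `g` are parallel for their own connections. -/
theorem pull_covDeriv_covDeriv (u v w z : Coord n) :
    h y (covDeriv h (fun y' => covDeriv h (fun _ => w) y' v) y u) z =
      ∑ j, g y (covDeriv g (fun y' => twistedDeriv g A θ j y' v w) y u) (A j y z) +
        ∑ j, g y (twistedDeriv g A θ j y v w) (twistedDeriv g A θ j y u z) +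
        ∑ j, ∑ l, θ j l y u * g y (twistedDeriv g A θ j y v w) (A l y z) -
        h y (christoffelMap h y v w) (christoffelMap h y u z) := by
  have hd : DifferentiableAt ℝ (fun y' => christoffelMap h y' v w) y :=
    (((contDiffAt_christoffelMap (s := 1) (H.pull_contDiffAt y hy) (H.pull_isInvertible y hy)
      (by norm_num) v).clm_apply contDiffAt_const).differentiableAt (by norm_num))
  have h1 := fderiv_metric_fields (H.pull_differentiableAt hy) (H.pull_symm_eventually hy)
    (H.pull_isInvertible y hy) hd (differentiableAt_const z) u
  have he : (fun y' => h y' (christoffelMap h y' v w) z) =ᶠ[𝓝 y]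
      fun y' => ∑ j, g y' (twistedDeriv g A θ j y' v w) (A j y' z) :=
    (H.eventually_mem hy).mono fun y' hy' => H.pull_christoffelMap hy' v w z
  have hdj (j : Fin m) :
      DifferentiableAt ℝ (fun y' => g y' (twistedDeriv g A θ j y' v w) (A j y' z)) y :=
    ((H.metric_differentiableAt hy).clm_apply (H.twistedDeriv_differentiableAt hy j v w)).clm_apply
      (H.op_apply_differentiableAt hy j z)
  rw [he.fderiv_eq, fderiv_fun_sum fun j _ => hdj j, sum_apply] at h1
  have hj (j : Fin m) :
      fderiv ℝ (fun y' => g y' (twistedDeriv g A θ j y' v w) (A j y' z)) y u =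
      g y (covDeriv g (fun y' => twistedDeriv g A θ j y' v w) y u) (A j y z) +
        g y (twistedDeriv g A θ j y v w) (twistedDeriv g A θ j y u z) +
        ∑ l, θ j l y u * g y (twistedDeriv g A θ j y v w) (A l y z) := by
    rw [fderiv_metric_fields (H.metric_differentiableAt hy) (H.metric_symm_eventually hy)
      (H.metric_isInvertible y hy) (H.twistedDeriv_differentiableAt hy j v w)
      (H.op_apply_differentiableAt hy j z), covDeriv_op_eq (θ := θ) j u z]
    simp only [map_add, map_sum, map_smul, smul_eq_mul]
    ring
  simp only [hj, Finset.sum_add_distrib, covDeriv_const] at h1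
  simp only [covDeriv_const]
  linarith

/-- The Gauss equation for the subbundle `{(A j v)_j}` of `TM ⊗ ℝᵐ`, when `θ` is flat at `y`. -/
theorem pull_riemann
    (hflat : ∀ i j u v, fderiv ℝ (θ i j) y u v - fderiv ℝ (θ i j) y v u +
      ∑ p, (θ i p y v * θ p j y u - θ i p y u * θ p j y v) = 0) (u v w z : Coord n) :
    h y (riemann h y u v w) z =
      ∑ j, g y (riemann g y u v (A j y w)) (A j y z) +
        (∑ j, g y (twistedNabla g A θ j y v w) (twistedNabla g A θ j y u z) -
          h y (christoffelMap h y v w - christoffelMap g y v w)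
            (christoffelMap h y u z - christoffelMap g y u z)) -
        (∑ j, g y (twistedNabla g A θ j y u w) (twistedNabla g A θ j y v z) -
          h y (christoffelMap h y u w - christoffelMap g y u w)
            (christoffelMap h y v z - christoffelMap g y v z)) := by
  rw [← H.sum_twistedDeriv_sub hy, ← H.sum_twistedDeriv_sub hy, riemann, map_sub, sub_apply,
    H.pull_covDeriv_covDeriv hy, H.pull_covDeriv_covDeriv hy]
  -- For a single `j` first-order terms in `θ` survive; only the `dθ` and `θ ∧ θ` terms are removed
  -- here, by flatness.
  have hR (j : Fin m) : g y (covDeriv g (fun y' => twistedDeriv g A θ j y' v w) y u) (A j y z) -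
      g y (covDeriv g (fun y' => twistedDeriv g A θ j y' u w) y v) (A j y z) =
      g y (riemann g y u v (A j y w)) (A j y z) -
        ∑ l, θ j l y v * g y (twistedDeriv g A θ l y u w) (A j y z) +
        ∑ l, θ j l y u * g y (twistedDeriv g A θ l y v w) (A j y z) := by
    have hz : ∑ q, (fderiv ℝ (θ j q) y u v - fderiv ℝ (θ j q) y v u +
        ∑ p, (θ j p y v * θ p q y u - θ j p y u * θ p q y v)) * g y (A q y w) (A j y z) = 0 :=
      Finset.sum_eq_zero fun q _ => by rw [hflat, zero_mul]
    rw [← covDeriv_covDeriv_sub (H.metric_contDiffAt y hy) (H.metric_isInvertible y hy)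
      (H.op_apply_contDiffAt hy j w), H.covDeriv_twistedDeriv hy, H.covDeriv_twistedDeriv hy]
    have hc (a b : Coord n) : ∑ q, (∑ p, θ j p y a * θ p q y b) * g y (A q y w) (A j y z) =
        ∑ l, θ j l y a * ∑ p, θ l p y b * g y (A p y w) (A j y z) := by
      simp only [Finset.sum_mul, Finset.mul_sum]
      rw [Finset.sum_comm]
      exact Finset.sum_congr rfl fun _ _ => Finset.sum_congr rfl fun _ _ => by ring
    simp only [add_mul, sub_mul, Finset.sum_add_distrib, Finset.sum_sub_distrib, hc] at hz
    simp only [map_add, map_sub, map_sum, map_smul, add_apply, sub_apply, sum_apply, smul_apply,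
      smul_eq_mul, Finset.sum_add_distrib, smul_add]
    linarith
  have hS := Finset.sum_congr rfl fun j (_ : j ∈ Finset.univ) => hR j
  simp only [Finset.sum_add_distrib, Finset.sum_sub_distrib] at hS
  -- Antisymmetry of `θ` cancels the leftover first-order terms against the double sums of
  -- `pull_covDeriv_covDeriv`.
  have h1 := H.sum_conn_antisymm hy v fun j l => g y (twistedDeriv g A θ l y u w) (A j y z)
  have h2 := H.sum_conn_antisymm hy u fun j l => g y (twistedDeriv g A θ l y v w) (A j y z)
  linarith

end CodazziTuple

end TwistedGauss

/-! ### The flat ambient form on the tangent spaces of a space form. -/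

section Ambient

variable {N : ℕ} {k : ℝ}

theorem ambForm_symm (k : ℝ) (N : ℕ) (a b : Amb N) : ambForm k N a b = ambForm k N b a := by
  simp only [ambForm_apply, mul_comm (a _)]

theorem ambForm_formNormal_self_ne {a : Amb N} (ha : a ∈ spaceForm k N) :
    ambForm k N (formNormal k a) (formNormal k a) ≠ 0 := by
  by_cases hk : k = 0
  · subst hk
    simp [formNormal, ambForm_apply, ambSign]
  · simp only [formNormal, hk, if_false, ha.2.1 hk]
    exact one_div_ne_zero hk

theorem ambForm_pos_of_nonneg (hk : 0 ≤ k) {b : Amb N} (hb : b ≠ 0) : 0 < ambForm k N b b := by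
  have h : ambForm k N b b = ∑ i, b i ^ 2 := by
    rw [ambForm_apply]
    exact Finset.sum_congr rfl fun i _ => by simp [ambSign, hk.not_gt, sq]
  rw [h, ← EuclideanSpace.real_norm_sq_eq]
  positivity

theorem ambForm_eq_of_neg (hk : k < 0) (a b : Amb N) :
    ambForm k N a b = -(a 0 * b 0) + ∑ i : Fin N, a i.succ * b i.succ := by
  simp [ambForm_apply, Fin.sum_univ_succ, ambSign, hk, Fin.succ_ne_zero]

/-- The flat form is positive definite on the tangent spaces of a space form. -/
theorem ambForm_pos {a : Amb N} (ha : a ∈ spaceForm k N) {b : Amb N}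
    (hab : ambForm k N b (formNormal k a) = 0) (hb : b ≠ 0) : 0 < ambForm k N b b := by
  rcases lt_or_ge k 0 with hk | hk
  · have haa := ha.2.1 hk.ne
    have h0 := ha.2.2 hk
    rw [formNormal, if_neg hk.ne, ambForm_eq_of_neg hk] at hab
    rw [ambForm_eq_of_neg hk] at haa ⊢
    have hneg : 1 / k < 0 := one_div_neg.mpr hk
    have hcs := Finset.sum_mul_sq_le_sq_mul_sq Finset.univ
      (fun i : Fin N => b i.succ) (fun i : Fin N => a i.succ)
    have hnn : 0 ≤ ∑ i : Fin N, b i.succ ^ 2 := Finset.sum_nonneg fun i _ => sq_nonneg _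
    simp only [← sq] at haa ⊢
    -- Reverse Cauchy-Schwarz in Lorentz space. If the spatial part of `b` is zero, orthogonality to
    -- the timelike `a` kills `b 0`. Otherwise `b 0 * a 0` is the spatial product, and
    -- Cauchy-Schwarz with the spatial part of `a` shorter than `a 0` contradicts `b` being
    -- non-spacelike.
    rcases hnn.eq_or_lt with hz | hpos
    · have hbi (i : Fin N) : b i.succ = 0 := by
        have := (Finset.sum_eq_zero_iff_of_nonneg fun i _ => sq_nonneg _).mp hz.symm i
          (Finset.mem_univ i)
        exact pow_eq_zero_iff (two_ne_zero) |>.mp this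
      refine absurd ?_ hb
      have hb0 : b 0 = 0 := by
        simp only [hbi, zero_mul, Finset.sum_const_zero, add_zero, neg_eq_zero] at hab
        exact (mul_eq_zero.mp hab).resolve_right h0.ne'
      ext i
      refine Fin.cases ?_ (fun i => ?_) i
      · simpa using hb0
      · simpa using hbi i
    · have h1 : ∑ i : Fin N, b i.succ * a i.succ = b 0 * a 0 := by linarith
      rw [h1] at hcs
      have h2 : ∑ i : Fin N, a i.succ ^ 2 < a 0 ^ 2 := by linarith
      by_contra hcon
      have h3 : ∑ i : Fin N, b i.succ ^ 2 ≤ b 0 ^ 2 := by linarith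
      have h4 : (∑ i : Fin N, b i.succ ^ 2) * ∑ i : Fin N, a i.succ ^ 2 <
          (∑ i : Fin N, b i.succ ^ 2) * a 0 ^ 2 := mul_lt_mul_of_pos_left h2 hpos
      have h5 : (∑ i : Fin N, b i.succ ^ 2) * a 0 ^ 2 ≤ b 0 ^ 2 * a 0 ^ 2 :=
        mul_le_mul_of_nonneg_right h3 (sq_nonneg _)
      rw [mul_pow] at hcs
      linarith
  · exact ambForm_pos_of_nonneg hk hb

end Ambient

/-! ### Structure equations of a framed patch: Gauss formula, Weingarten operators, Codazzi,
flatness. -/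

section Patch

variable {n m : ℕ}

/-- A smooth parametrized piece of a submanifold of a space form, over an open set `U`, with an
orthonormal frame of its normal bundle. -/
structure FramedPatch (k : ℝ) (X : Coord n → Amb (n + m)) (ξ : Fin m → Coord n → Amb (n + m))
    (U : Set (Coord n)) : Prop where
  isOpen : IsOpen U
  contDiffAt : ∀ y ∈ U, ContDiffAt ℝ ∞ X y
  mem_spaceForm : ∀ y ∈ U, X y ∈ spaceForm k (n + m)
  injective : ∀ y ∈ U, Function.Injective (fderiv ℝ X y)
  frame_contDiffAt : ∀ j, ∀ y ∈ U, ContDiffAt ℝ 3 (ξ j) y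
  isNormal : ∀ y ∈ U, ∀ j, IsNormal k X y (ξ j y)
  orthonormal : ∀ y ∈ U, ∀ i j, ambForm k (n + m) (ξ i y) (ξ j y) = if i = j then 1 else 0

/-- The connection forms of a normal frame. -/
def connForm (k : ℝ) (ξ : Fin m → Coord n → Amb (n + m)) (i j : Fin m) (y : Coord n) :
    Coord n →L[ℝ] ℝ :=
  ((ambForm k (n + m)).flip (ξ j y)) ∘L fderiv ℝ (ξ i) y

variable {k : ℝ} {X : Coord n → Amb (n + m)} {ξ : Fin m → Coord n → Amb (n + m)}
  {U : Set (Coord n)} {y : Coord n}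

theorem connForm_apply (i j : Fin m) (u : Coord n) :
    connForm k ξ i j y u = ambForm k (n + m) (fderiv ℝ (ξ i) y u) (ξ j y) := rfl

theorem firstForm_apply (u v : Coord n) :
    firstForm k X y u v = ambForm k (n + m) (fderiv ℝ X y u) (fderiv ℝ X y v) := rfl

theorem firstForm_symm (u v : Coord n) : firstForm k X y u v = firstForm k X y v u :=
  ambForm_symm _ _ _ _

theorem fderiv_ambForm {a b : Coord n → Amb (n + m)} (ha : DifferentiableAt ℝ a y)
    (hb : DifferentiableAt ℝ b y) (u : Coord n) :
    fderiv ℝ (fun y' => ambForm k (n + m) (a y') (b y')) y u =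
      ambForm k (n + m) (fderiv ℝ a y u) (b y) + ambForm k (n + m) (a y) (fderiv ℝ b y u) := by
  have h : HasFDerivAt (fun y' => ambForm k (n + m) (a y') (b y')) _ y :=
    ((ambForm k (n + m)).hasFDerivAt.comp y ha.hasFDerivAt).clm_apply hb.hasFDerivAt
  rw [h.fderiv]
  simp [add_comm]

theorem firstForm_symm_eventually (k : ℝ) (X : Coord n → Amb (n + m)) (y : Coord n) :
    ∀ᶠ y' in 𝓝 y, ∀ u v, firstForm k X y' u v = firstForm k X y' v u :=
  .of_forall fun _ => firstForm_symm

namespace FramedPatch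

variable (H : FramedPatch k X ξ U) (hy : y ∈ U)
include H hy

theorem eventually_mem : ∀ᶠ y' in 𝓝 y, y' ∈ U := H.isOpen.mem_nhds hy

theorem differentiableAt : DifferentiableAt ℝ X y :=
  (H.contDiffAt y hy).differentiableAt (by simp)

theorem contDiffAt_fderiv : ContDiffAt ℝ ∞ (fderiv ℝ X) y :=
  (H.contDiffAt y hy).fderiv_right (by simp)

theorem contDiffAt_fderiv_fderiv : ContDiffAt ℝ ∞ (fderiv ℝ (fderiv ℝ X)) y :=
  (H.contDiffAt_fderiv hy).fderiv_right (by simp)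

theorem fderiv_apply_differentiableAt (v : Coord n) :
    DifferentiableAt ℝ (fun y' => fderiv ℝ X y' v) y :=
  ((H.contDiffAt_fderiv hy).differentiableAt (by simp)).clm_apply (differentiableAt_const v)

theorem fderiv_fderiv_apply (u v : Coord n) :
    fderiv ℝ (fun y' => fderiv ℝ X y' v) y u = fderiv ℝ (fderiv ℝ X) y u v := by
  rw [(((H.contDiffAt_fderiv hy).differentiableAt (by simp)).hasFDerivAt.clm_apply
    (hasFDerivAt_const v y)).fderiv]
  simp

theorem fderiv_fderiv_symm (u v : Coord n) :
    fderiv ℝ (fderiv ℝ X) y u v = fderiv ℝ (fderiv ℝ X) y v u :=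
  ((H.contDiffAt y hy).isSymmSndFDerivAt (by simpa using ENat.LEInfty.out)).eq u v

theorem frame_differentiableAt (j : Fin m) : DifferentiableAt ℝ (ξ j) y :=
  (H.frame_contDiffAt j y hy).differentiableAt (by norm_num)

theorem hasFDerivAt_formNormal :
    HasFDerivAt (fun y' => formNormal k (X y')) ((if k = 0 then (0 : ℝ) else 1) • fderiv ℝ X y)
      y := by
  by_cases hk : k = 0
  · simp only [formNormal, hk, if_true, zero_smul]
    exact hasFDerivAt_const _ _
  · simp only [formNormal, hk, if_false, one_smul]
    exact (H.differentiableAt hy).hasFDerivAt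

/-- Derivative of the equation of the space form: `X 0 = 0` if `k = 0`, `⟨X, X⟩ = 1 / k` otherwise.
-/
theorem ambForm_fderiv_formNormal (u : Coord n) :
    ambForm k (n + m) (fderiv ℝ X y u) (formNormal k (X y)) = 0 := by
  by_cases hk : k = 0
  · have he : (fun y' => ambForm k (n + m) (X y') (EuclideanSpace.single 0 1)) =ᶠ[𝓝 y]
        fun _ => (0 : ℝ) := by
      filter_upwards [H.eventually_mem hy] with y' hy'
      have := (H.mem_spaceForm y' hy').1 hk
      simp [ambForm_apply, this]
    have h1 := fderiv_ambForm (k := k) (H.differentiableAt hy)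
      (differentiableAt_const (EuclideanSpace.single 0 1)) u
    rw [he.fderiv_eq] at h1
    simpa [formNormal, hk] using h1.symm
  · have he : (fun y' => ambForm k (n + m) (X y') (X y')) =ᶠ[𝓝 y] fun _ => 1 / k := by
      filter_upwards [H.eventually_mem hy] with y' hy'
      exact (H.mem_spaceForm y' hy').2.1 hk
    have h1 := fderiv_ambForm (k := k) (H.differentiableAt hy) (H.differentiableAt hy) u
    rw [he.fderiv_eq, ambForm_symm _ _ (X y)] at h1
    simp only [fderiv_fun_const, Pi.zero_apply, zero_apply] at h1
    simp only [formNormal, hk, if_false]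
    linarith

theorem firstForm_pos {u : Coord n} (hu : u ≠ 0) : 0 < firstForm k X y u u :=
  ambForm_pos (H.mem_spaceForm y hy) (H.ambForm_fderiv_formNormal hy u) fun h =>
    hu (H.injective y hy (by simpa using h))

theorem firstForm_isInvertible : (firstForm k X y).IsInvertible :=
  isInvertible_of_nondegenerate fun u hu => by
    by_contra hne
    exact (H.firstForm_pos hy hne).ne' (hu u)

theorem contDiffAt_firstForm : ContDiffAt ℝ ∞ (firstForm k X) y := by
  have h1 := H.contDiffAt_fderiv hy
  exact contDiffAt_clm_flip ((contDiffAt_clm_flip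
    ((contDiffAt_const (c := ambForm k (n + m))).clm_comp h1)).clm_comp h1)

/-- Pairing with the frame and with the normal of the space form shows that tangent vectors, that
normal and the frame are independent; the dimensions `n + (1 + m)` and `n + m + 1` agree, so they
span. -/
theorem exists_decomposition (ζ : Amb (n + m)) : ∃ (t : Coord n) (c : ℝ),
    ζ = fderiv ℝ X y t + c • formNormal k (X y) +
      ∑ j, ambForm k (n + m) ζ (ξ j y) • ξ j y := by
  set ν := formNormal k (X y) with hν
  have hνν : ambForm k (n + m) ν ν ≠ 0 := ambForm_formNormal_self_ne (H.mem_spaceForm y hy)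
  let Φ : (Coord n × ℝ × (Fin m → ℝ)) →ₗ[ℝ] Amb (n + m) :=
    (fderiv ℝ X y : Coord n →ₗ[ℝ] Amb (n + m)).coprod
      ((LinearMap.toSpanSingleton ℝ _ ν).coprod (Fintype.linearCombination ℝ fun j => ξ j y))
  have hΦ (t : Coord n) (c : ℝ) (s : Fin m → ℝ) :
      Φ (t, c, s) = fderiv ℝ X y t + c • ν + ∑ j, s j • ξ j y := by
    simp [Φ, Fintype.linearCombination_apply, add_assoc]
  have hξ (t : Coord n) (c : ℝ) (s : Fin m → ℝ) (i : Fin m) :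
      ambForm k (n + m) (Φ (t, c, s)) (ξ i y) = s i := by
    have h1 := (H.isNormal y hy i).2 t
    have h2 := (H.isNormal y hy i).1
    rw [ambForm_symm] at h1 h2
    simp [hΦ, h1, h2, H.orthonormal y hy, hν]
  have hn (t : Coord n) (c : ℝ) (s : Fin m → ℝ) :
      ambForm k (n + m) (Φ (t, c, s)) ν = c * ambForm k (n + m) ν ν := by
    simp [hΦ, hν, H.ambForm_fderiv_formNormal hy, (H.isNormal y hy _).1]
  have hinj : Function.Injective Φ := by
    rw [← LinearMap.ker_eq_bot, LinearMap.ker_eq_bot']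
    rintro ⟨t, c, s⟩ h0
    have hs : s = 0 := by
      ext i
      rw [← hξ t c s i, h0]
      simp
    have hc : c = 0 := by
      have := hn t c s
      rw [h0] at this
      simpa [hνν] using this.symm
    rw [hΦ] at h0
    have ht : t = 0 := H.injective y hy (by simpa [hs, hc] using h0)
    simp [hs, hc, ht]
  have hsurj : Function.Surjective Φ := by
    refine (LinearMap.injective_iff_surjective_of_finrank_eq_finrank ?_).mp hinj
    simp
    ring
  obtain ⟨⟨t, c, s⟩, hζ⟩ := hsurj ζ
  refine ⟨t, c, ?_⟩
  have hs (i : Fin m) : ambForm k (n + m) ζ (ξ i y) = s i := by rw [← hζ, hξ]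
  simp only [hs]
  rw [← hζ, hΦ]

theorem firstForm_tangentPart (ζ : Amb (n + m)) (v : Coord n) :
    firstForm k X y (tangentPart k X y ζ) v = ambForm k (n + m) ζ (fderiv ℝ X y v) := by
  simp [tangentPart, (H.firstForm_isInvertible hy).self_apply_inverse]

theorem tangentPart_fderiv (t : Coord n) : tangentPart k X y (fderiv ℝ X y t) = t :=
  metric_left_cancel (H.firstForm_isInvertible hy) fun w => by
    rw [H.firstForm_tangentPart hy, firstForm_apply]

theorem tangentPart_eq_zero {ζ : Amb (n + m)}
    (h : ∀ v, ambForm k (n + m) ζ (fderiv ℝ X y v) = 0) : tangentPart k X y ζ = 0 :=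
  metric_left_cancel (H.firstForm_isInvertible hy) fun w => by
    rw [H.firstForm_tangentPart hy, h]
    simp

theorem tangentPart_formNormal : tangentPart k X y (formNormal k (X y)) = 0 :=
  H.tangentPart_eq_zero hy fun v => by rw [ambForm_symm, H.ambForm_fderiv_formNormal hy]

theorem tangentPart_frame (j : Fin m) : tangentPart k X y (ξ j y) = 0 :=
  H.tangentPart_eq_zero hy (H.isNormal y hy j).2

theorem decomposition (ζ : Amb (n + m)) : ∃ c : ℝ,
    ζ = fderiv ℝ X y (tangentPart k X y ζ) + c • formNormal k (X y) +
      ∑ j, ambForm k (n + m) ζ (ξ j y) • ξ j y := by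
  obtain ⟨t, c, h⟩ := H.exists_decomposition hy ζ
  refine ⟨c, ?_⟩
  have ht : tangentPart k X y ζ = t := by
    conv_lhs => rw [h]
    simp [H.tangentPart_fderiv hy, H.tangentPart_formNormal hy, H.tangentPart_frame hy]
  rw [ht, ← h]

theorem normalPart_formProj (ζ : Amb (n + m)) :
    normalPart k X y (formProj k (X y) ζ) = ∑ j, ambForm k (n + m) ζ (ξ j y) • ξ j y := by
  obtain ⟨c, h⟩ := H.decomposition hy ζ
  have hνν := ambForm_formNormal_self_ne (H.mem_spaceForm y hy)
  have hc : ambForm k (n + m) ζ (formNormal k (X y)) =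
      c * ambForm k (n + m) (formNormal k (X y)) (formNormal k (X y)) := by
    conv_lhs => rw [h]
    simp [H.ambForm_fderiv_formNormal hy, (H.isNormal y hy _).1]
  have hp : formProj k (X y) ζ = ζ - c • formNormal k (X y) := by
    simp only [formProj, sub_apply, ContinuousLinearMap.id_apply,
      smul_apply, ContinuousLinearMap.smulRight_apply]
    rw [ambForm_symm k _ _ ζ, hc, smul_smul]
    congr 2
    field_simp
  rw [hp]
  simp only [normalPart, sub_apply, ContinuousLinearMap.id_apply, map_sub, map_smul,
    ContinuousLinearMap.comp_apply, H.tangentPart_formNormal hy, map_zero, sub_zero]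
  nth_rewrite 1 [h]
  abel

theorem secondForm_apply (u v : Coord n) : secondForm k X y u v =
    ∑ j, ambForm k (n + m) (fderiv ℝ (fderiv ℝ X) y u v) (ξ j y) • ξ j y := by
  rw [← H.normalPart_formProj hy]
  rfl

theorem firstForm_weingarten (ζ : Amb (n + m)) (u v : Coord n) :
    firstForm k X y (weingarten k X y ζ u) v = ambForm k (n + m) ζ (secondForm k X y u v) := by
  simp [weingarten, (H.firstForm_isInvertible hy).self_apply_inverse]

theorem ambForm_frame_secondForm (j : Fin m) (u v : Coord n) :
    ambForm k (n + m) (ξ j y) (secondForm k X y u v) =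
      ambForm k (n + m) (fderiv ℝ (fderiv ℝ X) y u v) (ξ j y) := by
  simp [H.secondForm_apply hy, H.orthonormal y hy]

theorem firstForm_weingarten_frame (j : Fin m) (u v : Coord n) :
    firstForm k X y (weingarten k X y (ξ j y) u) v =
      ambForm k (n + m) (fderiv ℝ (fderiv ℝ X) y u v) (ξ j y) := by
  rw [H.firstForm_weingarten hy, H.ambForm_frame_secondForm hy]

theorem weingarten_selfAdjoint (j : Fin m) (u v : Coord n) :
    firstForm k X y (weingarten k X y (ξ j y) u) v =
      firstForm k X y u (weingarten k X y (ξ j y) v) := by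
  rw [firstForm_symm u, H.firstForm_weingarten_frame hy, H.firstForm_weingarten_frame hy,
    H.fderiv_fderiv_symm hy]

theorem weingarten_sum (c : Fin m → ℝ) (v : Coord n) :
    weingarten k X y (∑ j, c j • ξ j y) v = ∑ j, c j • weingarten k X y (ξ j y) v :=
  metric_left_cancel (H.firstForm_isInvertible hy) fun w => by
    simp [H.firstForm_weingarten hy]

theorem normalDeriv_eq (ζ : Coord n → Amb (n + m)) (u : Coord n) : normalDeriv k X ζ y u =
    ∑ j, ambForm k (n + m) (fderiv ℝ ζ y u) (ξ j y) • ξ j y :=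
  H.normalPart_formProj hy _

theorem normalDeriv_frame (i : Fin m) (u : Coord n) : normalDeriv k X (ξ i) y u =
    ∑ j, connForm k ξ i j y u • ξ j y :=
  H.normalDeriv_eq hy _ _

theorem connForm_antisymm (i j : Fin m) (u : Coord n) :
    connForm k ξ i j y u = -connForm k ξ j i y u := by
  have he : (fun y' => ambForm k (n + m) (ξ i y') (ξ j y')) =ᶠ[𝓝 y]
      fun _ => if i = j then (1 : ℝ) else 0 :=
    (H.eventually_mem hy).mono fun y' hy' => H.orthonormal y' hy' i j
  have h1 := fderiv_ambForm (k := k) (H.frame_differentiableAt hy i)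
    (H.frame_differentiableAt hy j) u
  rw [he.fderiv_eq, ambForm_symm _ _ (ξ i y)] at h1
  simp only [fderiv_fun_const, Pi.zero_apply, zero_apply] at h1
  simp only [connForm_apply]
  linarith

theorem contDiffAt_connForm (i j : Fin m) : ContDiffAt ℝ 2 (connForm k ξ i j) y :=
  ((((ambForm k (n + m)).flip.contDiff.contDiffAt).comp y
    ((H.frame_contDiffAt j y hy).of_le (by norm_num)))).clm_comp
      ((H.frame_contDiffAt i y hy).fderiv_right (by norm_num))

theorem contDiffAt_weingarten (j : Fin m) :
    ContDiffAt ℝ 3 (fun y' => weingarten k X y' (ξ j y')) y := by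
  have h1 : ContDiffAt ℝ 3 (fun y' => ContinuousLinearMap.compL ℝ (Coord n) (Amb (n + m)) ℝ
      (ambForm k (n + m) (ξ j y'))) y :=
    (((ContinuousLinearMap.compL ℝ (Coord n) (Amb (n + m)) ℝ).comp
      (ambForm k (n + m))).contDiff.contDiffAt).comp y (H.frame_contDiffAt j y hy)
  have h2 : ContDiffAt ℝ 3 (fun y' => (firstForm k X y').inverse) y :=
    contDiffAt_clm_inverse ((H.contDiffAt_firstForm hy).of_le (ENat.LEInfty.out))
      (H.firstForm_isInvertible hy)
  have h3 : ContDiffAt ℝ 3 (fderiv ℝ (fderiv ℝ X)) y :=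
    (H.contDiffAt_fderiv_fderiv hy).of_le (ENat.LEInfty.out)
  -- On `U` the projections in `secondForm` disappear when paired with `ξ j`, so `weingarten` agrees
  -- with an expression in the second derivative of `X` whose regularity is visible.
  refine (h2.clm_comp (h1.clm_comp h3)).congr_of_eventuallyEq ?_
  filter_upwards [H.eventually_mem hy] with y' hy'
  ext1 u
  refine metric_left_cancel (H.firstForm_isInvertible hy') fun w => ?_
  rw [H.firstForm_weingarten_frame hy', ambForm_symm]
  simp [(H.firstForm_isInvertible hy').self_apply_inverse]

/-- The tangential part of the second derivative of `X` is symmetric and compatible with the induced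
metric, so Koszul uniqueness applies. -/
theorem christoffelMap_firstForm (u v : Coord n) :
    christoffelMap (firstForm k X) y u v =
      tangentPart k X y (fderiv ℝ (fderiv ℝ X) y u v) := by
  refine christoffelMap_unique (C := fun a b => tangentPart k X y (fderiv ℝ (fderiv ℝ X) y a b))
    (firstForm_symm_eventually k X y) (H.firstForm_isInvertible hy)
    (fun a b => by rw [H.fderiv_fderiv_symm hy]) (fun a b c => ?_) u v
  rw [← fderiv_metric_apply ((H.contDiffAt_firstForm hy).differentiableAt (by simp))]
  simp only [firstForm_apply]
  rw [fderiv_ambForm (H.fderiv_apply_differentiableAt hy b) (H.fderiv_apply_differentiableAt hy c),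
    H.fderiv_fderiv_apply hy, H.fderiv_fderiv_apply hy, ← firstForm_apply, ← firstForm_apply,
    firstForm_symm b, H.firstForm_tangentPart hy, H.firstForm_tangentPart hy,
    ambForm_symm _ _ (fderiv ℝ X y b)]

/-- The normal of the space form has derivative `0` or `dX`, and `ξ j` is orthogonal to both. Hence
the space form adds no term to the Codazzi equation. -/
theorem ambForm_fderiv_frame_formNormal (j : Fin m) (u : Coord n) :
    ambForm k (n + m) (fderiv ℝ (ξ j) y u) (formNormal k (X y)) = 0 := by
  have he : (fun y' => ambForm k (n + m) (ξ j y') (formNormal k (X y'))) =ᶠ[𝓝 y]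
      fun _ => (0 : ℝ) :=
    (H.eventually_mem hy).mono fun y' hy' => (H.isNormal y' hy' j).1
  have hn := H.hasFDerivAt_formNormal hy
  have h1 := fderiv_ambForm (k := k) (H.frame_differentiableAt hy j) hn.differentiableAt u
  rw [he.fderiv_eq, hn.fderiv] at h1
  simpa only [fderiv_fun_const, Pi.zero_apply, zero_apply, smul_apply, map_smul,
    (H.isNormal y hy j).2, smul_zero, add_zero] using h1.symm

theorem ambForm_fderiv_frame_fderiv (j : Fin m) (u v : Coord n) :
    ambForm k (n + m) (fderiv ℝ (ξ j) y u) (fderiv ℝ X y v) =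
      -ambForm k (n + m) (fderiv ℝ (fderiv ℝ X) y u v) (ξ j y) := by
  have he : (fun y' => ambForm k (n + m) (ξ j y') (fderiv ℝ X y' v)) =ᶠ[𝓝 y]
      fun _ => (0 : ℝ) :=
    (H.eventually_mem hy).mono fun y' hy' => (H.isNormal y' hy' j).2 v
  have h1 := fderiv_ambForm (k := k) (H.frame_differentiableAt hy j)
    (H.fderiv_apply_differentiableAt hy v) u
  rw [he.fderiv_eq, H.fderiv_fderiv_apply hy, ambForm_symm _ _ (ξ j y)] at h1
  simp only [fderiv_fun_const, Pi.zero_apply, zero_apply] at h1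
  linarith

theorem nablaA_eq (j : Fin m) (u v : Coord n) :
    nablaA k X (ξ j) y u v =
      twistedNabla (firstForm k X) (fun i y' => weingarten k X y' (ξ i y')) (connForm k ξ)
        j y u v := by
  rw [nablaA, H.normalDeriv_frame hy, H.weingarten_sum hy, covDeriv_const, twistedNabla,
    twistedDeriv]
  abel

/-- The Codazzi equation in terms of the third derivative of the parametrization. -/
theorem firstForm_nabla (j : Fin m) (u v w : Coord n) :
    firstForm k X y (twistedNabla (firstForm k X) (fun i y' => weingarten k X y' (ξ i y'))
      (connForm k ξ) j y u v) w =
      ambForm k (n + m) (fderiv ℝ (fderiv ℝ (fderiv ℝ X)) y u v w) (ξ j y) -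
        firstForm k X y (weingarten k X y (ξ j y) u) (christoffelMap (firstForm k X) y v w) -
        firstForm k X y (weingarten k X y (ξ j y) v) (christoffelMap (firstForm k X) y u w) -
        firstForm k X y (weingarten k X y (ξ j y) (christoffelMap (firstForm k X) y u v)) w := by
  have hA : DifferentiableAt ℝ (fun y' => weingarten k X y' (ξ j y') v) y :=
    ((H.contDiffAt_weingarten hy j).differentiableAt (by norm_num)).clm_apply
      (differentiableAt_const v)
  have h1 := fderiv_metric_fields ((H.contDiffAt_firstForm hy).differentiableAt (by simp))
    (firstForm_symm_eventually k X y) (H.firstForm_isInvertible hy) hA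
    (differentiableAt_const w) u
  have he : (fun y' => firstForm k X y' (weingarten k X y' (ξ j y') v) w) =ᶠ[𝓝 y]
      fun y' => ambForm k (n + m) (fderiv ℝ (fderiv ℝ X) y' v w) (ξ j y') :=
    (H.eventually_mem hy).mono fun y' hy' => H.firstForm_weingarten_frame hy' j v w
  have hd2 : DifferentiableAt ℝ (fderiv ℝ (fderiv ℝ X)) y :=
    (H.contDiffAt_fderiv_fderiv hy).differentiableAt (by simp)
  have hd : HasFDerivAt (fun y' => fderiv ℝ (fderiv ℝ X) y' v w) _ y :=
    (hd2.hasFDerivAt.clm_apply (hasFDerivAt_const v y)).clm_apply (hasFDerivAt_const w y)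
  rw [he.fderiv_eq, fderiv_ambForm hd.differentiableAt (H.frame_differentiableAt hy j),
    hd.fderiv, covDeriv_const] at h1
  -- Split the second derivative of `X`: its tangential part gives the Christoffel term, its frame
  -- part the connection forms, and its part along the normal of the space form pairs to zero with
  -- `dξ_j`.
  have h2 : ambForm k (n + m) (fderiv ℝ (fderiv ℝ X) y v w) (fderiv ℝ (ξ j) y u) =
      -firstForm k X y (weingarten k X y (ξ j y) u) (christoffelMap (firstForm k X) y v w) +
        ∑ l, connForm k ξ j l y u * firstForm k X y (weingarten k X y (ξ l y) v) w := by
    obtain ⟨c, hc⟩ := H.decomposition hy (fderiv ℝ (fderiv ℝ X) y v w)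
    rw [H.firstForm_weingarten_frame hy, ← H.ambForm_fderiv_frame_fderiv hy,
      H.christoffelMap_firstForm hy, ambForm_symm]
    conv_lhs => rw [hc]
    simp only [map_add, map_smul, map_sum, smul_eq_mul, H.ambForm_fderiv_frame_formNormal hy,
      mul_zero, add_zero, H.firstForm_weingarten_frame hy, connForm_apply]
    congr 1
    exact Finset.sum_congr rfl fun l _ => mul_comm _ _
  simp only [ContinuousLinearMap.comp_zero, zero_add, ContinuousLinearMap.flip_apply] at h1
  rw [twistedNabla, twistedDeriv]
  simp only [map_sub, map_sum, map_smul, sub_apply, sum_apply, smul_apply, smul_eq_mul]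
  rw [h2] at h1
  linarith

theorem nabla_symm (j : Fin m) (u v : Coord n) :
    twistedNabla (firstForm k X) (fun i y' => weingarten k X y' (ξ i y')) (connForm k ξ) j y u v =
      twistedNabla (firstForm k X) (fun i y' => weingarten k X y' (ξ i y')) (connForm k ξ)
        j y v u := by
  have hs : fderiv ℝ (fderiv ℝ (fderiv ℝ X)) y u v = fderiv ℝ (fderiv ℝ (fderiv ℝ X)) y v u :=
    ((H.contDiffAt_fderiv hy).isSymmSndFDerivAt (by simpa using ENat.LEInfty.out)).eq u v
  refine metric_left_cancel (H.firstForm_isInvertible hy) fun w => ?_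
  -- In `firstForm_nabla` the two middle terms are swapped by exchanging `u` and `v`; the others are
  -- symmetric.
  rw [H.firstForm_nabla hy, H.firstForm_nabla hy, hs, christoffelMap_symm
    ((H.contDiffAt_firstForm hy).differentiableAt (by simp))
    (firstForm_symm_eventually k X y) (H.firstForm_isInvertible hy) u v]
  ring

theorem thirdForm_apply (u v : Coord n) :
    thirdForm k X ξ y u v = ∑ j, firstForm k X y (weingarten k X y (ξ j y) u)
      (weingarten k X y (ξ j y) v) := by
  simp only [thirdForm, obata, ContinuousLinearMap.comp_apply, sum_apply, map_sum]
  exact Finset.sum_congr rfl fun j _ => H.weingarten_selfAdjoint hy j _ _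

/-- A sum of squares `g(A_j u, A_j u)`; if it vanishes, all `A_j u` vanish, so `II(u, ·) = 0` and
zero nullity gives `u = 0`. -/
theorem thirdForm_pos (hnull : ZeroNullityAt k X y) {u : Coord n} (hu : u ≠ 0) :
    0 < thirdForm k X ξ y u u := by
  have hnn (a : Coord n) : 0 ≤ firstForm k X y a a := by
    rcases eq_or_ne a 0 with rfl | ha
    · simp
    · exact (H.firstForm_pos hy ha).le
  rw [H.thirdForm_apply hy]
  refine (Finset.sum_nonneg fun j _ => hnn _).lt_of_ne fun h0 => hu (hnull u fun v => ?_)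
  rw [H.secondForm_apply hy]
  refine Finset.sum_eq_zero fun j _ => ?_
  have hj := (Finset.sum_eq_zero_iff_of_nonneg fun j _ => hnn _).mp h0.symm j (Finset.mem_univ j)
  have hA : weingarten k X y (ξ j y) u = 0 := by
    by_contra hne
    exact (H.firstForm_pos hy hne).ne' hj
  rw [← H.firstForm_weingarten_frame hy, hA]
  simp

theorem thirdForm_isInvertible (hnull : ZeroNullityAt k X y) :
    (thirdForm k X ξ y).IsInvertible :=
  isInvertible_of_nondegenerate fun u hu => by
    by_contra hne
    exact (H.thirdForm_pos hy hnull hne).ne' (hu u)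

theorem contDiffAt_thirdForm : ContDiffAt ℝ 3 (thirdForm k X ξ) y :=
  ((H.contDiffAt_firstForm hy).of_le (ENat.LEInfty.out)).clm_comp
    (ContDiffAt.sum fun j _ => (H.contDiffAt_weingarten hy j).clm_comp
      (H.contDiffAt_weingarten hy j))

omit hy in
theorem codazziTuple (hnull : ∀ y ∈ U, ZeroNullityAt k X y) :
    CodazziTuple U (firstForm k X) (thirdForm k X ξ) (fun j y' => weingarten k X y' (ξ j y'))
      (connForm k ξ) where
  isOpen := H.isOpen
  metric_contDiffAt _ hy := (H.contDiffAt_firstForm hy).of_le (ENat.LEInfty.out)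
  metric_symm _ _ := firstForm_symm
  metric_isInvertible _ hy := H.firstForm_isInvertible hy
  pull_contDiffAt _ hy := (H.contDiffAt_thirdForm hy).of_le (by norm_num)
  pull_isInvertible _ hy := H.thirdForm_isInvertible hy (hnull _ hy)
  pull_apply _ hy := H.thirdForm_apply hy
  op_contDiffAt j _ hy := (H.contDiffAt_weingarten hy j).of_le (by norm_num)
  conn_contDiffAt i j _ hy := (H.contDiffAt_connForm hy i j).of_le (by norm_num)
  conn_antisymm i j _ hy := H.connForm_antisymm hy i j
  codazzi j _ hy := H.nabla_symm hy j

theorem normalDeriv_normalDeriv_frame (i j : Fin m) (u v : Coord n) :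
    ambForm k (n + m) (normalDeriv k X (fun y' => normalDeriv k X (ξ i) y' v) y u) (ξ j y) =
      fderiv ℝ (connForm k ξ i j) y u v +
        ∑ p, connForm k ξ i p y v * connForm k ξ p j y u := by
  have he : (fun y' => normalDeriv k X (ξ i) y' v) =ᶠ[𝓝 y]
      fun y' => ∑ p, connForm k ξ i p y' v • ξ p y' :=
    (H.eventually_mem hy).mono fun y' hy' => H.normalDeriv_frame hy' i v
  have hc (p : Fin m) : HasFDerivAt (fun y' => connForm k ξ i p y' v) _ y :=
    ((H.contDiffAt_connForm hy i p).differentiableAt (by norm_num)).hasFDerivAt.clm_apply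
      (hasFDerivAt_const v y)
  have hd : HasFDerivAt (fun y' => ∑ p, connForm k ξ i p y' v • ξ p y') _ y :=
    HasFDerivAt.fun_sum fun p (_ : p ∈ Finset.univ) =>
      (hc p).fun_smul (H.frame_differentiableAt hy p).hasFDerivAt
  rw [H.normalDeriv_eq hy, he.fderiv_eq, hd.fderiv]
  simp [H.orthonormal y hy, Finset.sum_add_distrib, connForm_apply]
  ring

/-- The structure equation of a flat normal connection. -/
theorem connForm_flat (hflat : NormallyFlatAt k X y) (hξ : ∀ j, ContDiffAt ℝ ∞ (ξ j) y)
    (i j : Fin m) (u v : Coord n) :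
    fderiv ℝ (connForm k ξ i j) y u v - fderiv ℝ (connForm k ξ i j) y v u +
      ∑ p, (connForm k ξ i p y v * connForm k ξ p j y u -
        connForm k ξ i p y u * connForm k ξ p j y v) = 0 := by
  -- Normal flatness is tested on the frame fields themselves, then read off in the component along
  -- `ξ j`.
  have h := hflat (ξ i) (hξ i) ((H.eventually_mem hy).mono fun y' hy' => H.isNormal y' hy' i) u v
  have h1 := congrArg (fun ζ => ambForm k (n + m) ζ (ξ j y)) h
  simp only [normalCurv, map_sub, sub_apply, H.normalDeriv_normalDeriv_frame hy, map_zero,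
    zero_apply] at h1
  rw [Finset.sum_sub_distrib]
  linarith

end FramedPatch

end Patch

/-! ### The inverse square root of a positive self-adjoint operator. -/

section InvSqrt

theorem exists_invSqrt_of_isSymmetric {F : Type*} [NormedAddCommGroup F] [InnerProductSpace ℝ F]
    [FiniteDimensional ℝ F] {W : F →ₗ[ℝ] F} (hW : W.IsSymmetric)
    (hpos : ∀ u, u ≠ 0 → 0 < inner ℝ (W u) u) :
    ∃ S : F →ₗ[ℝ] F, (∀ u v, inner ℝ (S u) v = inner ℝ u (S v)) ∧
      (∀ u, u ≠ 0 → 0 < inner ℝ (S u) u) ∧ ∀ u, S (S (W u)) = u := by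
  let b := hW.eigenvectorBasis rfl
  let l := hW.eigenvalues rfl
  have hb (i) : W (b i) = l i • b i := hW.apply_eigenvectorBasis rfl i
  have hl (i) : 0 < l i := by
    have h := hpos (b i) (b.orthonormal.ne_zero i)
    rw [hb, real_inner_smul_left, real_inner_self_eq_norm_sq, b.orthonormal.1 i] at h
    simpa using h
  -- Diagonal in an orthonormal eigenbasis of `W`, with entries the inverse square roots of the
  -- eigenvalues.
  let S : F →ₗ[ℝ] F := ∑ i, (√(l i))⁻¹ • (innerₛₗ ℝ (b i)).smulRight (b i)
  have hS (u : F) : S u = ∑ i, ((√(l i))⁻¹ * inner ℝ (b i) u) • b i := by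
    simp [S, smul_smul]
  have hSv (u v : F) :
      inner ℝ (S u) v = ∑ i, (√(l i))⁻¹ * inner ℝ (b i) u * inner ℝ (b i) v := by
    simp [hS, sum_inner, real_inner_smul_left]
  have hSb (i) : S (b i) = (√(l i))⁻¹ • b i := by
    simp [hS, b.inner_eq_ite]
  refine ⟨S, fun u v => ?_, fun u hu => ?_, fun u => ?_⟩
  · rw [hSv, real_inner_comm, hSv]
    exact Finset.sum_congr rfl fun i _ => by ring
  · rw [hSv]
    have hc (i) : 0 < (√(l i))⁻¹ := inv_pos.mpr (Real.sqrt_pos.mpr (hl i))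
    have hterm (i) : 0 ≤ (√(l i))⁻¹ * inner ℝ (b i) u * inner ℝ (b i) u := by
      rw [mul_assoc]
      exact mul_nonneg (hc i).le (mul_self_nonneg _)
    refine (Finset.sum_nonneg fun i _ => hterm i).lt_of_ne fun h0 => hu ?_
    have hi (i) : inner ℝ (b i) u = 0 := by
      have h := (Finset.sum_eq_zero_iff_of_nonneg fun i _ => hterm i).mp h0.symm i
        (Finset.mem_univ i)
      rw [mul_assoc] at h
      simpa [(hc i).ne'] using h
    rw [← b.sum_repr' u]
    exact Finset.sum_eq_zero fun i _ => by rw [hi, zero_smul]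
  · have h : S ∘ₗ S ∘ₗ W = LinearMap.id := b.toBasis.ext fun i => by
      have hne : √(l i) ≠ 0 := (Real.sqrt_pos.mpr (hl i)).ne'
      have hmul : l i * ((√(l i))⁻¹ * (√(l i))⁻¹) = 1 := by
        rw [← mul_inv, Real.mul_self_sqrt (hl i).le, mul_inv_cancel₀ (hl i).ne']
      simp only [OrthonormalBasis.coe_toBasis, LinearMap.comp_apply, hb, map_smul, hSb,
        LinearMap.id_apply, smul_smul]
      rw [mul_assoc, hmul, one_smul]
    exact LinearMap.congr_fun h u

/-- Stated on a bare vector space so that `g` itself can serve as the inner product, without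
clashing with the Euclidean one on `Coord n`. -/
theorem exists_invSqrt_of_bilinear {V : Type*} [AddCommGroup V] [Module ℝ V]
    [FiniteDimensional ℝ V] {g : V →ₗ[ℝ] V →ₗ[ℝ] ℝ} (hsymm : ∀ u v, g u v = g v u)
    (hg : ∀ u, u ≠ 0 → 0 < g u u) {W : V →ₗ[ℝ] V} (hW : ∀ u v, g (W u) v = g u (W v))
    (hpos : ∀ u, u ≠ 0 → 0 < g (W u) u) :
    ∃ S : V →ₗ[ℝ] V, (∀ u v, g (S u) v = g u (S v)) ∧ (∀ u, u ≠ 0 → 0 < g (S u) u) ∧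
      ∀ u, S (S (W u)) = u := by
  let core : InnerProductSpace.Core ℝ V :=
    { inner := fun u v => g u v
      conj_inner_symm := fun u v => by simp [hsymm u v]
      re_inner_nonneg := fun u => by
        rcases eq_or_ne u 0 with rfl | hu
        · simp
        · exact (hg u hu).le
      add_left := fun u v w => by simp
      smul_left := fun u v r => by simp
      definite := fun u hu => by
        by_contra hne
        exact (hg u hne).ne' hu }
  let _ : NormedAddCommGroup V := core.toNormedAddCommGroup
  let _ : InnerProductSpace ℝ V := InnerProductSpace.ofCore core.toCore
  exact exists_invSqrt_of_isSymmetric (W := W) hW hpos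

variable {n : ℕ} {g : Coord n →L[ℝ] Coord n →L[ℝ] ℝ} {W : Coord n →L[ℝ] Coord n}

theorem invSqrt_spec (hsymm : ∀ u v, g u v = g v u) (hg : ∀ u, u ≠ 0 → 0 < g u u)
    (hW : ∀ u v, g (W u) v = g u (W v)) (hpos : ∀ u, u ≠ 0 → 0 < g (W u) u) :
    (∀ u v, g (invSqrt g W u) v = g u (invSqrt g W v)) ∧
      (∀ u, u ≠ 0 → 0 < g (invSqrt g W u) u) ∧
      (invSqrt g W ∘L invSqrt g W) ∘L W = ContinuousLinearMap.id ℝ (Coord n) := by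
  refine Classical.epsilon_spec (p := fun S : Coord n →L[ℝ] Coord n =>
    (∀ u v, g (S u) v = g u (S v)) ∧ (∀ u, u ≠ 0 → 0 < g (S u) u) ∧
      (S ∘L S) ∘L W = ContinuousLinearMap.id ℝ (Coord n)) ?_
  obtain ⟨S, h1, h2, h3⟩ := exists_invSqrt_of_bilinear
    (g := (ContinuousLinearMap.coeLM ℝ).comp (g : Coord n →ₗ[ℝ] Coord n →L[ℝ] ℝ))
    (W := (W : Coord n →ₗ[ℝ] Coord n)) hsymm hg hW hpos
  exact ⟨LinearMap.toContinuousLinearMap S, h1, h2, ContinuousLinearMap.ext h3⟩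

/-- Makes `W^{-1/2}` an isometry from `g` to `g(W ·, ·)`. The argument works for any operator
allowed by `invSqrt`, so its uniqueness plays no role. -/
theorem metric_invSqrt (hsymm : ∀ u v, g u v = g v u) (hg : ∀ u, u ≠ 0 → 0 < g u u)
    (hW : ∀ u v, g (W u) v = g u (W v)) (hpos : ∀ u, u ≠ 0 → 0 < g (W u) u) (a b : Coord n) :
    g (W (invSqrt g W a)) (invSqrt g W b) = g a b := by
  obtain ⟨h1, -, h3⟩ := invSqrt_spec hsymm hg hW hpos
  set S := invSqrt g W
  -- In finite dimension the one-sided inverse `S (S W) = 1` also gives `(S W) S = 1`.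
  have h4 : (S : Coord n →ₗ[ℝ] Coord n) * ((S : Coord n →ₗ[ℝ] Coord n) * W) = 1 :=
    LinearMap.ext fun u => congrArg (fun f : Coord n →L[ℝ] Coord n => f u) h3
  have h5 : S (W (S a)) = a := LinearMap.congr_fun (mul_eq_one_comm.mp h4) a
  rw [← h1, h5]

end InvSqrt

/-! ### Raising the last index of a Kulkarni-Nomizu square. -/

section Hat

variable {n : ℕ} {G : Coord n →L[ℝ] Coord n →L[ℝ] ℝ}

/-- The four terms of the product agree in pairs by symmetry of `G`. Taking `h` linear in its second
argument makes the product a linear functional of `z`, so the vector chosen by `hat` exists. -/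
theorem metric_hat_kulkarniNomizu (hsymm : ∀ u v, G u v = G v u) (hinv : G.IsInvertible)
    (h : Coord n → Coord n →L[ℝ] Coord n) (u v w z : Coord n) :
    G (hat G (kulkarniNomizu (fun a b => G a b) (fun a b => h a b) (fun a b => h a b)) u v w) z =
      G (h u w) (h v z) - G (h u z) (h v w) := by
  have hS (z : Coord n) :
      kulkarniNomizu (fun a b => G a b) (fun a b => h a b) (fun a b => h a b) u v w z =
        G (h u w) (h v z) - G (h u z) (h v w) := by
    rw [kulkarniNomizu, hsymm (h v z), hsymm (h v w)]
    ring
  have hex : ∃ a, ∀ z, G a z =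
      kulkarniNomizu (fun a b => G a b) (fun a b => h a b) (fun a b => h a b) u v w z := by
    refine ⟨G.inverse (G (h u w) ∘L h v - G (h v w) ∘L h u), fun z => ?_⟩
    rw [hS, hsymm (h u z), hinv.self_apply_inverse]
    simp
  rw [hat, Classical.epsilon_spec hex z, hS]

end Hat

/-! ### Identification of `T`, `J_j`, `L` and the curvature decomposition. -/

section Decomposition

variable {n m : ℕ} {k : ℝ} {X : Coord n → Amb (n + m)} {ξ : Fin m → Coord n → Amb (n + m)}
  {U : Set (Coord n)} {y : Coord n}

theorem diffT_eq (u v : Coord n) : diffT k X ξ y u v =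
    (christoffelMap (thirdForm k X ξ) y u - christoffelMap (firstForm k X) y u) v := by
  simp [diffT, covDeriv_const]

/-- The covariant derivative `∇_u A_j` of a Weingarten operator as a continuous linear map. -/
def nablaMap (k : ℝ) (X : Coord n → Amb (n + m)) (ξ : Fin m → Coord n → Amb (n + m))
    (j : Fin m) (y u : Coord n) : Coord n →L[ℝ] Coord n :=
  fderiv ℝ (fun y' => weingarten k X y' (ξ j y')) y u +
    christoffelMap (firstForm k X) y u ∘L weingarten k X y (ξ j y) -
    (∑ l, connForm k ξ j l y u • weingarten k X y (ξ l y)) -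
    weingarten k X y (ξ j y) ∘L christoffelMap (firstForm k X) y u

namespace FramedPatch

variable (H : FramedPatch k X ξ U) (hy : y ∈ U)
include H hy

theorem nablaMap_apply (j : Fin m) (u v : Coord n) : nablaMap k X ξ j y u v =
    twistedNabla (firstForm k X) (fun i y' => weingarten k X y' (ξ i y')) (connForm k ξ)
      j y u v := by
  rw [twistedNabla, twistedDeriv,
    covDeriv_clm_apply ((H.contDiffAt_weingarten hy j).differentiableAt (by norm_num))]
  simp [nablaMap]

theorem tensorJ_eq (j : Fin m) (u v : Coord n) : tensorJ k X ξ y j u v =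
    (invSqrt (firstForm k X y) (obata k X ξ y) ∘L nablaMap k X ξ j y u) v := by
  rw [tensorJ, H.nablaA_eq hy, ContinuousLinearMap.comp_apply, H.nablaMap_apply hy]

theorem obata_selfAdjoint (u v : Coord n) :
    firstForm k X y (obata k X ξ y u) v = firstForm k X y u (obata k X ξ y v) := by
  have h (a b : Coord n) : firstForm k X y (obata k X ξ y a) b = thirdForm k X ξ y a b := rfl
  rw [firstForm_symm u, h, h, H.thirdForm_apply hy, H.thirdForm_apply hy]
  exact Finset.sum_congr rfl fun j _ => firstForm_symm _ _

theorem thirdForm_invSqrt (hnull : ZeroNullityAt k X y) (a b : Coord n) :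
    thirdForm k X ξ y (invSqrt (firstForm k X y) (obata k X ξ y) a)
      (invSqrt (firstForm k X y) (obata k X ξ y) b) = firstForm k X y a b :=
  metric_invSqrt firstForm_symm (fun _ => H.firstForm_pos hy) (H.obata_selfAdjoint hy)
    (fun _ => H.thirdForm_pos hy hnull) a b

theorem obata_isInvertible (hnull : ZeroNullityAt k X y) : (obata k X ξ y).IsInvertible := by
  have h : obata k X ξ y = (firstForm k X y).inverse ∘L thirdForm k X ξ y := by
    ext1 u
    simp [thirdForm, (H.firstForm_isInvertible hy).inverse_apply_self]
  rw [h]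
  exact (H.firstForm_isInvertible hy).inverse.comp (H.thirdForm_isInvertible hy hnull)

theorem thirdForm_obata_inverse (hnull : ZeroNullityAt k X y) (a b : Coord n) :
    thirdForm k X ξ y ((obata k X ξ y).inverse a) b = firstForm k X y a b := by
  rw [thirdForm, ContinuousLinearMap.comp_apply,
    (H.obata_isInvertible hy hnull).self_apply_inverse]

theorem diffT_eq_obata_inverse (hnull : ∀ y ∈ U, ZeroNullityAt k X y) (u v : Coord n) :
    diffT k X ξ y u v = (obata k X ξ y).inverse
      (∑ j, weingarten k X y (ξ j y) (nablaA k X (ξ j) y u v)) := by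
  refine metric_left_cancel (H.thirdForm_isInvertible hy (hnull y hy)) fun w => ?_
  rw [H.thirdForm_obata_inverse hy (hnull y hy), diffT_eq, sub_apply,
    (H.codazziTuple hnull).pull_christoffelMap_sub hy, map_sum, sum_apply]
  exact Finset.sum_congr rfl fun j _ => by
    rw [H.weingarten_selfAdjoint hy, H.nablaA_eq hy]

theorem diffT_symm (hnull : ZeroNullityAt k X y) (u v : Coord n) :
    diffT k X ξ y u v = diffT k X ξ y v u := by
  have h3 : ∀ᶠ y' in 𝓝 y, ∀ u v, thirdForm k X ξ y' u v = thirdForm k X ξ y' v u := by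
    filter_upwards [H.eventually_mem hy] with y' hy' a b
    rw [H.thirdForm_apply hy', H.thirdForm_apply hy']
    exact Finset.sum_congr rfl fun j _ => firstForm_symm _ _
  rw [diffT_eq, diffT_eq, sub_apply, sub_apply,
    christoffelMap_symm ((H.contDiffAt_thirdForm hy).differentiableAt (by norm_num)) h3
      (H.thirdForm_isInvertible hy hnull) u v,
    christoffelMap_symm ((H.contDiffAt_firstForm hy).differentiableAt (by simp))
      (firstForm_symm_eventually k X y) (H.firstForm_isInvertible hy) u v]

theorem tensorJ_symm (j : Fin m) (u v : Coord n) :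
    tensorJ k X ξ y j u v = tensorJ k X ξ y j v u := by
  rw [tensorJ, tensorJ, H.nablaA_eq hy, H.nablaA_eq hy, H.nabla_symm hy]

/-- The commutator in `L` is what `R` lacks to represent, with respect to III, the curvature of `TM
⊗ ℝᵐ` compressed to the image of `A`. -/
theorem thirdForm_tensorL (hnull : ZeroNullityAt k X y) (u v w z : Coord n) :
    thirdForm k X ξ y (tensorL k X ξ y u v w) z =
      ∑ j, firstForm k X y (riemann (firstForm k X) y u v (weingarten k X y (ξ j y) w))
        (weingarten k X y (ξ j y) z) -
      thirdForm k X ξ y (riemann (firstForm k X) y u v w) z := by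
  rw [tensorL, H.thirdForm_obata_inverse hy hnull, map_sum, sum_apply, H.thirdForm_apply hy,
    ← Finset.sum_sub_distrib]
  exact Finset.sum_congr rfl fun j _ => by
    rw [H.weingarten_selfAdjoint hy, curvOp, map_sub, sub_apply]

/-- The decomposition of the curvature tensor of the third fundamental form. -/
theorem riemann_thirdForm (hnull : ∀ y ∈ U, ZeroNullityAt k X y) (hflat : NormallyFlatAt k X y)
    (hξ : ∀ j, ContDiffAt ℝ ∞ (ξ j) y) (u v w : Coord n) :
    riemann (thirdForm k X ξ) y u v w = riemann (firstForm k X) y u v w + tensorL k X ξ y u v w +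
      hat (thirdForm k X ξ y) (kulkarniNomizu (fun a b => thirdForm k X ξ y a b)
        (diffT k X ξ y) (diffT k X ξ y)) u v w -
      ∑ j, hat (thirdForm k X ξ y) (kulkarniNomizu (fun a b => thirdForm k X ξ y a b)
        (tensorJ k X ξ y j) (tensorJ k X ξ y j)) u v w := by
  have hC := H.codazziTuple hnull
  have hinv := H.thirdForm_isInvertible hy (hnull y hy)
  -- `T` and the `J_j` are rewritten as families of linear maps, the form required by
  -- `metric_hat_kulkarniNomizu`.
  have hT : diffT k X ξ y = fun a b =>
      (christoffelMap (thirdForm k X ξ) y a - christoffelMap (firstForm k X) y a) b := by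
    ext1 a; ext1 b; exact diffT_eq a b
  have hJ (j : Fin m) : tensorJ k X ξ y j = fun a b =>
      (invSqrt (firstForm k X y) (obata k X ξ y) ∘L nablaMap k X ξ j y a) b := by
    ext1 a; ext1 b; exact H.tensorJ_eq hy j a b
  refine metric_left_cancel hinv fun z => ?_
  rw [hT]
  simp only [hJ]
  rw [map_sub, map_add, map_add, map_sum, sub_apply, add_apply, add_apply, sum_apply]
  rw [metric_hat_kulkarniNomizu (hC.pull_symm hy) hinv
    (fun a => christoffelMap (thirdForm k X ξ) y a - christoffelMap (firstForm k X) y a)]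
  simp only [fun j => metric_hat_kulkarniNomizu (hC.pull_symm hy) hinv
    (fun a => invSqrt (firstForm k X y) (obata k X ξ y) ∘L nablaMap k X ξ j y a)]
  simp only [ContinuousLinearMap.comp_apply, H.thirdForm_invSqrt hy (hnull y hy),
    H.nablaMap_apply hy, H.thirdForm_tensorL hy (hnull y hy), Finset.sum_sub_distrib]
  rw [hC.pull_riemann hy (H.connForm_flat hy hflat hξ)]
  simp only [sub_apply]
  have hs := hC.pull_symm hy
    (christoffelMap (thirdForm k X ξ) y u z - christoffelMap (firstForm k X) y u z)
    (christoffelMap (thirdForm k X ξ) y v w - christoffelMap (firstForm k X) y v w)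
  have hn := Finset.sum_congr rfl fun j (_ : j ∈ Finset.univ) => hC.metric_symm y hy
    (twistedNabla (firstForm k X) (fun i y' => weingarten k X y' (ξ i y')) (connForm k ξ) j y u z)
    (twistedNabla (firstForm k X) (fun i y' => weingarten k X y' (ξ i y')) (connForm k ξ) j y v w)
  rw [hs, hn]
  ring

end FramedPatch

end Decomposition

/-! ### From the manifold to a framed patch in a chart. -/

section Chart

variable {n m : ℕ} {k : ℝ} {M : Type*} [TopologicalSpace M] [ChartedSpace (Coord n) M]
  {x : M → Amb (n + m)} {e : OpenPartialHomeomorph M (Coord n)}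
  {y : Coord n}

theorem contDiffAt_comp_chart_symm (hx : ContMDiff 𝓘(ℝ, Coord n) 𝓘(ℝ, Amb (n + m)) ∞ x)
    (he : e ∈ IsManifold.maximalAtlas 𝓘(ℝ, Coord n) ∞ M) (hy : y ∈ e.target) :
    ContDiffAt ℝ ∞ (x ∘ e.symm) y := by
  have h1 := (contMDiffOn_symm_of_mem_maximalAtlas he).contMDiffAt (e.open_target.mem_nhds hy)
  exact (hx.contMDiffAt.comp y h1).contDiffAt

theorem injective_fderiv_comp_chart_symm
    (hx : ContMDiff 𝓘(ℝ, Coord n) 𝓘(ℝ, Amb (n + m)) ∞ x)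
    (himm : ∀ p, Function.Injective (mfderiv 𝓘(ℝ, Coord n) 𝓘(ℝ, Amb (n + m)) x p))
    (he : e ∈ IsManifold.maximalAtlas 𝓘(ℝ, Coord n) ∞ M) (hy : y ∈ e.target) :
    Function.Injective (fderiv ℝ (x ∘ e.symm) y) := by
  have hs : MDifferentiableAt 𝓘(ℝ, Coord n) 𝓘(ℝ, Coord n) e.symm y :=
    ((contMDiffOn_symm_of_mem_maximalAtlas he).contMDiffAt
      (e.open_target.mem_nhds hy)).mdifferentiableAt (by simp)
  have hd : e.MDifferentiable 𝓘(ℝ, Coord n) 𝓘(ℝ, Coord n) :=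
    ⟨(contMDiffOn_of_mem_maximalAtlas he).mdifferentiableOn (by simp),
      (contMDiffOn_symm_of_mem_maximalAtlas he).mdifferentiableOn (by simp)⟩
  rw [← mfderiv_eq_fderiv, mfderiv_comp y (hx.contMDiffAt.mdifferentiableAt (by simp)) hs]
  exact (himm _).comp (hd.symm.mfderiv_injective hy)

theorem IsNormalFrameAt.exists_framedPatch {ξ : Fin m → Coord n → Amb (n + m)}
    (hξ : IsNormalFrameAt k (x ∘ e.symm) ξ y)
    (hx : ContMDiff 𝓘(ℝ, Coord n) 𝓘(ℝ, Amb (n + m)) ∞ x)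
    (himm : ∀ p, Function.Injective (mfderiv 𝓘(ℝ, Coord n) 𝓘(ℝ, Amb (n + m)) x p))
    (hform : ∀ p, x p ∈ spaceForm k (n + m))
    (he : e ∈ IsManifold.maximalAtlas 𝓘(ℝ, Coord n) ∞ M) (hy : y ∈ e.target) :
    ∃ U ⊆ e.target, y ∈ U ∧ FramedPatch k (x ∘ e.symm) ξ U := by
  -- `ContDiffAt ℝ ∞` at a point gives, for each finite order, a neighbourhood of that regularity,
  -- but not a common one for all orders; hence the finite order `3` in `FramedPatch`.
  have h1 : ∀ᶠ y' in 𝓝 y, ∀ j, ContDiffAt ℝ 3 (ξ j) y' :=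
    Filter.eventually_all.mpr fun j =>
      ((hξ.1 j).of_le (m := 3) ENat.LEInfty.out).eventually (by decide)
  obtain ⟨U, hU, hopen, hyU⟩ := eventually_nhds_iff.mp
    ((h1.and hξ.2).and (e.open_target.mem_nhds hy))
  exact ⟨U, fun y' hy' => (hU y' hy').2, hyU,
    { isOpen := hopen
      contDiffAt := fun y' hy' => contDiffAt_comp_chart_symm hx he (hU y' hy').2
      mem_spaceForm := fun y' _ => hform _
      injective := fun y' hy' => injective_fderiv_comp_chart_symm hx himm he (hU y' hy').2
      frame_contDiffAt := fun j y' hy' => (hU y' hy').1.1 j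
      isNormal := fun y' hy' => (hU y' hy').1.2.1
      orthonormal := fun y' hy' => (hU y' hy').1.2.2 }⟩

end Chart

end GaussObata

end

theorem corollary2 (n m : ℕ) (k : ℝ)
    {M : Type*} [TopologicalSpace M] [ChartedSpace (GaussObata.Coord n) M]
    [IsManifold 𝓘(ℝ, GaussObata.Coord n) ∞ M]
    -- a smooth immersion of `M` into the space form of dimension `n + m` and curvature `k`
    (x : M → GaussObata.Amb (n + m))
    (hx : ContMDiff 𝓘(ℝ, GaussObata.Coord n) 𝓘(ℝ, GaussObata.Amb (n + m)) ∞ x)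
    (himm : ∀ p, Function.Injective
      (mfderiv 𝓘(ℝ, GaussObata.Coord n) 𝓘(ℝ, GaussObata.Amb (n + m)) x p))
    (hform : ∀ p, x p ∈ GaussObata.spaceForm k (n + m))
    -- flat normal bundle
    (hflat : ∀ e ∈ IsManifold.maximalAtlas 𝓘(ℝ, GaussObata.Coord n) ∞ M, ∀ y ∈ e.target,
      GaussObata.NormallyFlatAt k (x ∘ e.symm) y)
    -- null extrinsic zero index
    (hnull : ∀ e ∈ IsManifold.maximalAtlas 𝓘(ℝ, GaussObata.Coord n) ∞ M, ∀ y ∈ e.target,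
      GaussObata.ZeroNullityAt k (x ∘ e.symm) y)
    -- a chart, a point of it, and a smooth orthonormal frame of the normal bundle near the point
    (e : OpenPartialHomeomorph M (GaussObata.Coord n))
    (he : e ∈ IsManifold.maximalAtlas 𝓘(ℝ, GaussObata.Coord n) ∞ M)
    (y : GaussObata.Coord n) (hy : y ∈ e.target)
    (ξ : Fin m → GaussObata.Coord n → GaussObata.Amb (n + m))
    (hξ : GaussObata.IsNormalFrameAt k (x ∘ e.symm) ξ y) :
    -- `T = W⁻¹ ∑ j, A_j ∇A_j`
    (∀ u v, GaussObata.diffT k (x ∘ e.symm) ξ y u v =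
      (GaussObata.obata k (x ∘ e.symm) ξ y).inverse
        (∑ j, GaussObata.weingarten k (x ∘ e.symm) y (ξ j y)
          (GaussObata.nablaA k (x ∘ e.symm) (ξ j) y u v))) ∧
    -- `T` and the `J_j` are symmetric
    (∀ u v, GaussObata.diffT k (x ∘ e.symm) ξ y u v =
      GaussObata.diffT k (x ∘ e.symm) ξ y v u) ∧
    (∀ j u v, GaussObata.tensorJ k (x ∘ e.symm) ξ y j u v =
      GaussObata.tensorJ k (x ∘ e.symm) ξ y j v u) ∧
    -- the decomposition of the curvature tensor
    (∀ u v w, GaussObata.riemann (GaussObata.thirdForm k (x ∘ e.symm) ξ) y u v w =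
      GaussObata.riemann (GaussObata.firstForm k (x ∘ e.symm)) y u v w +
      GaussObata.tensorL k (x ∘ e.symm) ξ y u v w +
      GaussObata.hat (GaussObata.thirdForm k (x ∘ e.symm) ξ y)
        (GaussObata.kulkarniNomizu (fun a b => GaussObata.thirdForm k (x ∘ e.symm) ξ y a b)
          (GaussObata.diffT k (x ∘ e.symm) ξ y)
          (GaussObata.diffT k (x ∘ e.symm) ξ y)) u v w -
      ∑ j, GaussObata.hat (GaussObata.thirdForm k (x ∘ e.symm) ξ y)
        (GaussObata.kulkarniNomizu (fun a b => GaussObata.thirdForm k (x ∘ e.symm) ξ y a b)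
          (GaussObata.tensorJ k (x ∘ e.symm) ξ y j)
          (GaussObata.tensorJ k (x ∘ e.symm) ξ y j)) u v w) := by
  obtain ⟨U, hUe, hyU, H⟩ := hξ.exists_framedPatch hx himm hform he hy
  have hnull' : ∀ y' ∈ U, GaussObata.ZeroNullityAt k (x ∘ e.symm) y' := fun y' hy' =>
    hnull e he y' (hUe hy')
  exact ⟨H.diffT_eq_obata_inverse hyU hnull', H.diffT_symm hyU (hnull e he y hy),
    H.tensorJ_symm hyU, H.riemann_thirdForm hyU hnull' (hflat e he y hy) hξ.1⟩
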